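/- **Setting.** Let $n\ge 3$, $p>n$ and $\tau\in\left(\frac{n-2}{2},n-2\right)$. Let $M$ be a smooth $n$-manifold with a compact subset $K$ such that $M\setminus K$ is the disjoint union of finitely many ends $E_1,\dots,E_N$, each with a fixed diffeomorphism $\Phi_k:E_k\to\mathbb R^n\setminus B_1$, where $B_1$ is the closed unit ball, and fix finitely many coordinate charts $U_1,\dots,U_{N'}$ of $M$ covering $K$. For $q\in[1,\infty]$, $k\in\mathbb Z_{\ge0}$, $s\in\mathbb R$ put $$\|u\|_{W^{k,q}_{s}(\mathbb R^n\setminus B_1)}=\sum_{|I|\le k}\Big(\int_{\mathbb R^n\setminus B_1}\big(|\partial^Iu|\,|x|^{|I|-s}\big)^q|x|^{-n}\,dx\Big)^{1/q}$$ (essential suprema if $q=\infty$), and $\|u\|_{W^{k,q}_{s}}=\sum_k\|u\|_{W^{k,q}_{s}(E_k)}+\sum_i\|u\|_{W^{k,q}(U_i)}$ on $M$, each norm being computed in the corresponding coordinates; $L^q_s=W^{0,q}_s$. Norms of symmetric $(0,2)$-tensors are sums of the norms of their components. $\|g-g_{\mathbb E}\|_{W^{2,p}_{-\tau}}$ denotes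 the sum over the ends and over $i,j$ of $\|g_{ij}-\delta_{ij}\|_{W^{2,p}_{-\tau}(E_k)}$. For a smooth Riemannian metric $g$ and a smooth function $f$ on $M$, let $P(g,f)=R(g)+2\Delta_gf-|df|_g^2$, where $R(g)$ is the scalar curvature. The triple $(M,g,f)$ is an asymptotically flat (AF) weighted manifold of $(p,\tau)$-type if $g_{ij}-\delta_{ij}$ and $f$ belong to $W^{2,p}_{-\tau}(E_k)$ on each end, $R(g)$ and $\Delta_gf$ belong to $L^\infty_{-2\tau-2}$, $P(g,f)\in L^1(M,\mathrm{dvol}_g)$ and, if $n=3$, moreover $g_{ij}-\delta_{ij}\in W^{1,\infty}_{-1}(E_k)$ on each end. The weighted mass of an end $E$ is $$m(M,g,f,E)=2(n-1)\omega_{n-1}\,m_{\mathrm{ADM}}(M,g,E)+2\lim_{\rho\to\infty}\int_{S_\rho}\partial_if\,\nu^i\,e^{-f}\,d\sigma,$$ $$m_{\mathrm{ADM}}(M,g,E)=\frac1{2(n-1)\omega_{n-1}}\lim_{\rho\to\infty}\int_{S_\rho}(\partial_jg_{ij}-\partial_ig_{jj})\,\nu^i\,d\sigma,$$ where $\omega_{n-1}$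 is the volume of the unit sphere in $\mathbb R^n$, and $S_\rho=\{|x|=\rho\}$, $\nu$, $d\sigma$ are the coordinate sphere, its outward unit normal and its area element, all Euclidean in the coordinates of $E$. **Lemma (continuity of the weighted mass in $W^{2,p}_{-\tau}$).** For every $\varepsilon>0$ and all finite $a,b,c\ge0$ there is a constant $\delta>0$, depending only on $\varepsilon,n,p,\tau,a,b,c$ (in particular not on $M$, its ends or its charts), with the following property. Let $(M,g,f)$ and $(M,\hat g,\hat f)$ be AF weighted manifolds of $(p,\tau)$-type with the same underlying manifold, ends and charts, such that $$\|g-g_{\mathbb E}\|_{W^{2,p}_{-\tau}}\le a,\qquad \|f\|_{W^{2,p}_{-\tau}}\le b,\qquad \|P(g,f)-P(\hat g,\hat f)\|_{L^1_{-2\tau-2}}\le c,$$ $$\|\hat g-g\|_{W^{2,p}_{-\tau}}<\delta,\qquad \|\hat f-f\|_{W^{2,p}_{-\tau}}<\delta .$$ Then for each end $E_k$ the weighted masses of $(g,f)$ and $(\hat g,\hat f)$ exist (the defining limits converge to real numbers), and $$|m(M,g,f,E_k)-m(M,\hat g,\hat f,E_k)|<\varepsilon .$$ -/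

import Mathlib

open Set Filter Topology MeasureTheory Manifold
open scoped ENNReal NNReal ContDiff

noncomputable section

namespace WeightedMass

/-- Euclidean `n`-space. -/
abbrev Euc (n : ℕ) := EuclideanSpace ℝ (Fin n)

/-! ### Calculus in coordinates -/

/-- The partial derivative `∂_i u`. -/
def pd {n : ℕ} (i : Fin n) (u : Euc n → ℝ) (x : Euc n) : ℝ :=
  fderiv ℝ u x (EuclideanSpace.single i 1)

/-- The iterated partial derivative `∂_{i₁} ⋯ ∂_{iₘ} u` along a list of indices. -/
def pdList {n : ℕ} : List (Fin n) → (Euc n → ℝ) → Euc n → ℝ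
  | [], u => u
  | i :: l, u => pd i (pdList l u)

/-- The multi-indices `I` of order `|I| = m`, written as nondecreasing words `i₁ ≤ ⋯ ≤ iₘ`. -/
def multiIndices (n m : ℕ) : Finset (Fin m → Fin n) := by
  classical exact Finset.univ.filter Monotone

/-! ### Sobolev norms

The functions of the theory are smooth, so that weak derivatives are classical ones; the
norms take values in `[0, ∞]`, and a smooth function belongs to the space if and only if its
norm is finite. -/

/-- The norm of `W^{k,p}(Ω)`: the sum over the multi-indices `|I| ≤ k` of the `L^p(Ω)` norms
of `∂^I u`. -/
def sobolevNorm {n : ℕ} (Ω : Set (Euc n)) (k : ℕ) (p : ℝ≥0∞) (u : Euc n → ℝ) : ℝ≥0∞ :=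
  ∑ m ∈ Finset.range (k + 1), ∑ I ∈ multiIndices n m,
    eLpNorm (pdList (List.ofFn I) u) p (volume.restrict Ω)

/-- The exterior region `ℝⁿ \ B₁`, with `B₁` the closed unit ball. -/
def exterior (n : ℕ) : Set (Euc n) := {x | 1 < ‖x‖}

/-- The measure `|x|^{-n} dx` on `ℝⁿ \ B₁`. -/
def scaleMeasure (n : ℕ) : Measure (Euc n) :=
  (volume.restrict (exterior n)).withDensity (fun x => ENNReal.ofReal (‖x‖ ^ (-(n : ℝ))))

/-- The norm of the weighted space `W^{k,p}_s(ℝⁿ \ B₁)`: the sum over the multi-indices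
`|I| ≤ k` of `(∫ (|∂^I u| |x|^{|I| - s})^p |x|^{-n} dx)^{1/p}` (an essential supremum when
`p = ∞`). A function in `W^{k,p}_{-τ}` decays like `|x|^{-τ}`. -/
def weightedNorm {n : ℕ} (k : ℕ) (p : ℝ≥0∞) (s : ℝ) (u : Euc n → ℝ) : ℝ≥0∞ :=
  ∑ m ∈ Finset.range (k + 1), ∑ I ∈ multiIndices n m,
    eLpNorm (fun x => pdList (List.ofFn I) u x * ‖x‖ ^ ((m : ℝ) - s)) p (scaleMeasure n)

/-! ### Curvature in coordinates

`G x` is the matrix `(g_{ij}(x))` of a metric in a coordinate system. -/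

/-- The Christoffel symbol `Γ^k_{ij}`. -/
def christoffel {n : ℕ} (G : Euc n → Matrix (Fin n) (Fin n) ℝ) (k i j : Fin n)
    (x : Euc n) : ℝ :=
  1 / 2 * ∑ l, (G x)⁻¹ k l *
    (pd i (fun y => G y j l) x + pd j (fun y => G y i l) x - pd l (fun y => G y i j) x)

/-- The Ricci curvature
`R_{ij} = ∂_k Γ^k_{ij} - ∂_j Γ^k_{ik} + Γ^k_{kl} Γ^l_{ij} - Γ^k_{jl} Γ^l_{ik}`. -/
def ricci {n : ℕ} (G : Euc n → Matrix (Fin n) (Fin n) ℝ) (i j : Fin n) (x : Euc n) : ℝ :=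
  ∑ k, (pd k (christoffel G k i j) x - pd j (christoffel G k i k) x
    + ∑ l, (christoffel G k k l x * christoffel G l i j x
      - christoffel G k j l x * christoffel G l i k x))

/-- The scalar curvature `R(g) = g^{ij} R_{ij}`. -/
def scalarCurvature {n : ℕ} (G : Euc n → Matrix (Fin n) (Fin n) ℝ) (x : Euc n) : ℝ :=
  ∑ i, ∑ j, (G x)⁻¹ i j * ricci G i j x

/-- The Laplacian `Δ_g f = g^{ij} (∂_i ∂_j f - Γ^k_{ij} ∂_k f)`. -/
def laplacian {n : ℕ} (G : Euc n → Matrix (Fin n) (Fin n) ℝ) (f : Euc n → ℝ)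
    (x : Euc n) : ℝ :=
  ∑ i, ∑ j, (G x)⁻¹ i j * (pd i (pd j f) x - ∑ k, christoffel G k i j x * pd k f x)

/-- The squared length `|df|_g² = g^{ij} ∂_i f ∂_j f`. -/
def gradSq {n : ℕ} (G : Euc n → Matrix (Fin n) (Fin n) ℝ) (f : Euc n → ℝ)
    (x : Euc n) : ℝ :=
  ∑ i, ∑ j, (G x)⁻¹ i j * (pd i f x * pd j f x)

/-- The `P`-scalar curvature `P(g,f) = R(g) + 2 Δ_g f - |df|_g²`. -/
def pScalarCurvature {n : ℕ} (G : Euc n → Matrix (Fin n) (Fin n) ℝ) (f : Euc n → ℝ)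
    (x : Euc n) : ℝ :=
  scalarCurvature G x + 2 * laplacian G f x - gradSq G f x

/-! ### Tensors and functions on a manifold -/

section Manifold

variable {n : ℕ} {M : Type*} [TopologicalSpace M] [ChartedSpace (Euc n) M]
  [IsManifold (𝓡 n) ∞ M]

variable (n M) in
/-- Smooth Riemannian metrics on `M`. -/
abbrev RiemMetric :=
  Bundle.ContMDiffRiemannianMetric (𝓡 n) ∞ (Euc n) (TangentSpace (𝓡 n) : M → Type _)

/-- The matrix of components `g_{ij} = g(∂_i, ∂_j)` of a metric in the chart `φ`, as a
function on `φ.target`. -/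
def components (g : RiemMetric n M) (φ : OpenPartialHomeomorph M (Euc n)) (x : Euc n) :
    Matrix (Fin n) (Fin n) ℝ :=
  Matrix.of fun i j =>
    g.inner (φ.symm x)
      (mfderiv (𝓡 n) (𝓡 n) φ.symm x (EuclideanSpace.single i (1 : ℝ) : Euc n))
      (mfderiv (𝓡 n) (𝓡 n) φ.symm x (EuclideanSpace.single j (1 : ℝ) : Euc n))

/-- The expression of a function on `M` in the chart `φ`. -/
def inChart (f : M → ℝ) (φ : OpenPartialHomeomorph M (Euc n)) (x : Euc n) : ℝ :=
  f (φ.symm x)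

variable (n M) in
/-- A manifold with finitely many ends: a compact set `K`, whose complement is the disjoint
union of finitely many ends `E_k`, each with a diffeomorphism onto `ℝⁿ \ B₁`, together with
finitely many coordinate charts `U_i` covering `K`. -/
structure EndStructure where
  /-- the compact core -/
  K : Set M
  isCompact_K : IsCompact K
  /-- the number of ends -/
  N : ℕ
  /-- the diffeomorphism `Φ_k : E_k → ℝⁿ \ B₁`, with `E_k` its source -/
  endChart : Fin N → OpenPartialHomeomorph M (Euc n)
  endChart_mem : ∀ k, endChart k ∈ IsManifold.maximalAtlas (𝓡 n) ∞ M
  endChart_target : ∀ k, (endChart k).target = exterior n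
  disjoint_ends : Pairwise fun k l => Disjoint (endChart k).source (endChart l).source
  compl_K : Kᶜ = ⋃ k, (endChart k).source
  /-- the number of charts covering the core -/
  N' : ℕ
  /-- the coordinate chart on `U_i`, with `U_i` its source -/
  coreChart : Fin N' → OpenPartialHomeomorph M (Euc n)
  coreChart_mem : ∀ i, coreChart i ∈ IsManifold.maximalAtlas (𝓡 n) ∞ M
  K_subset : K ⊆ ⋃ i, (coreChart i).source

namespace EndStructure

variable (S : EndStructure n M)

/-- The norm of `W^{k,p}_s` on `M`: the sum of the weighted norms on the ends `E_k` and of the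
unweighted norms on the `U_i`. The function on `M` is given through its expression `u φ` in
each coordinate chart `φ`. -/
def norm (k : ℕ) (p : ℝ≥0∞) (s : ℝ)
    (u : OpenPartialHomeomorph M (Euc n) → Euc n → ℝ) : ℝ≥0∞ :=
  ∑ e, weightedNorm k p s (u (S.endChart e))
    + ∑ i, sobolevNorm (S.coreChart i).target k p (u (S.coreChart i))

/-- The norm of the tensor `ĝ - g` in `W^{k,p}_s` on `M`: the sum over its components. -/
def normMetricSub (k : ℕ) (p : ℝ≥0∞) (s : ℝ) (ghat g : RiemMetric n M) : ℝ≥0∞ :=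
  ∑ i, ∑ j, S.norm k p s (fun φ x => components ghat φ x i j - components g φ x i j)

/-- The norm in `W^{k,p}_s(E_e)` of `g - g_𝔼`, on the end `E_e`: the sum over the components
`g_{ij} - δ_{ij}`. -/
def endNormSubEuclidean (k : ℕ) (p : ℝ≥0∞) (s : ℝ) (g : RiemMetric n M) (e : Fin S.N) : ℝ≥0∞ :=
  ∑ i, ∑ j, weightedNorm k p s
    (fun x => components g (S.endChart e) x i j - (1 : Matrix (Fin n) (Fin n) ℝ) i j)

/-- The expression of `P(g,f)` in each coordinate chart. -/
def _root_.WeightedMass.pScalar (g : RiemMetric n M) (f : M → ℝ)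
    (φ : OpenPartialHomeomorph M (Euc n)) : Euc n → ℝ :=
  pScalarCurvature (components g φ) (inChart f φ)

/-- Integrability on `M` with respect to `dvol_g` of a function given through its expression in
each coordinate chart: integrability on each of the finitely many charts that cover `M`, where
`dvol_g = √(det g) dx`. -/
def IntegrableOnM (g : RiemMetric n M) (u : OpenPartialHomeomorph M (Euc n) → Euc n → ℝ) : Prop :=
  (∀ e, IntegrableOn (fun x => u (S.endChart e) x * √(components g (S.endChart e) x).det)
    (S.endChart e).target) ∧
  (∀ i, IntegrableOn (fun x => u (S.coreChart i) x * √(components g (S.coreChart i) x).det)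
    (S.coreChart i).target)

/-- `(M, g, f)` is an asymptotically flat weighted manifold of `(p,τ)`-type, with respect to
the given core, ends and charts. -/
structure IsAF (p τ : ℝ) (g : RiemMetric n M) (f : M → ℝ) : Prop where
  three_le : 3 ≤ n
  smooth : ContMDiff (𝓡 n) 𝓘(ℝ, ℝ) ∞ f
  metric_decay : ∀ e, S.endNormSubEuclidean 2 (ENNReal.ofReal p) (-τ) g e < ⊤
  weight_decay : ∀ e,
    weightedNorm 2 (ENNReal.ofReal p) (-τ) (inChart f (S.endChart e)) < ⊤
  scalar_decay : S.norm 0 ⊤ (-2 * τ - 2) (fun φ => scalarCurvature (components g φ)) < ⊤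
  laplacian_decay :
    S.norm 0 ⊤ (-2 * τ - 2) (fun φ => laplacian (components g φ) (inChart f φ)) < ⊤
  integrable : S.IntegrableOnM g (pScalar g f)
  dim_three : n = 3 → ∀ e, S.endNormSubEuclidean 1 ⊤ (-1) g e < ⊤

end EndStructure

/-! ### The mass of an end -/

/-- The integral `∫_{S_ρ} F(x, ν) dσ` over the coordinate sphere `|x| = ρ`, with respect to
Euclidean surface measure, where `ν = x / ρ` is the outward unit normal. -/
def sphereIntegral (ρ : ℝ) (F : Euc n → Euc n → ℝ) : ℝ :=
  ρ ^ (n - 1) * ∫ ν : Metric.sphere (0 : Euc n) 1, F (ρ • (ν : Euc n)) ν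
    ∂(volume : Measure (Euc n)).toSphere

variable (n) in
/-- The volume `ω_{n-1}` of the unit sphere in `ℝⁿ`. -/
def sphereVolume : ℝ := ((volume : Measure (Euc n)).toSphere univ).toReal

/-- `m` is the ADM mass of the end with chart `Φ`:
`m = lim_{ρ → ∞} 1 / (2 (n-1) ω_{n-1}) ∫_{S_ρ} (∂_j g_{ij} - ∂_i g_{jj}) ν^i dσ`. -/
def IsADMMass (g : RiemMetric n M) (Φ : OpenPartialHomeomorph M (Euc n)) (m : ℝ) : Prop :=
  Tendsto (fun ρ : ℝ => 1 / (2 * ((n : ℝ) - 1) * sphereVolume n) *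
    sphereIntegral ρ fun x ν => ∑ i, ∑ j,
      (pd j (fun y => components g Φ y i j) x - pd i (fun y => components g Φ y j j) x) * ν i)
    atTop (𝓝 m)

/-- `m` is the weighted mass of the end with chart `Φ`:
`m = 2 (n-1) ω_{n-1} m_ADM + 2 lim_{ρ → ∞} ∫_{S_ρ} ∂_i f ν^i e^{-f} dσ`, the ADM mass and the
limit being required to exist. -/
def IsWeightedMass (g : RiemMetric n M) (f : M → ℝ) (Φ : OpenPartialHomeomorph M (Euc n))
    (m : ℝ) : Prop :=
  ∃ mADM L : ℝ, IsADMMass g Φ mADM ∧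
    Tendsto (fun ρ : ℝ => sphereIntegral ρ fun x ν =>
      ∑ i, pd i (inChart f Φ) x * ν i * Real.exp (-(inChart f Φ x))) atTop (𝓝 L) ∧
    m = 2 * ((n : ℝ) - 1) * sphereVolume n * mADM + 2 * L

end Manifold

end WeightedMass

end

/-! The mass of an end is the limit of fluxes through large spheres of the fields `admField` (`∂_j
g_{ij} - ∂_i g_{jj}`) and, twice, `weightField` (`e^{-f} ∂_i f`). In end coordinates their combined
divergence is `P(g,f)` plus an error quadratic in the deviation from the flat metric with zero
weight: `|∂g|² + |∂f|²` and `(|g - δ| + |f|)(|∂²g| + |∂²f|)`.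

Put `β = τ + 1 - n/2`, which is positive because `τ > (n-2)/2`. A weighted Morrey inequality, valid
for `p > n`, gives `O(|x|^{-τ})` for a function of `W^{2,p}_{-τ}` and `O(|x|^{-τ-1})` for its
gradient. Hölder makes its second derivatives integrable against `|x|^{1-n/2}`. Hence the quadratic
error has integral `O(r^{-β})` over `|x| > r`, with a constant depending only on the norm bounds
(`exists_lintegral_quadError_le`). Since `R` and `Δf` are `O(|x|^{-2τ-2})` with `2τ + 2 > n`, each
divergence is separately integrable near infinity. So both limits exist (`tendsto_flux`), and each
equals the flux through `S_r` plus the integral of the divergence outside `S_r`.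

For two pairs, the difference of masses is therefore a difference of fluxes through one sphere `S_r`
plus a tail integral. The tail is controlled by the two quadratic errors and by `P(g,f) - P(ĝ,f̂)`.
The `L¹_{-2τ-2}` norm carries the weight `|x|^{2β}`, so a mere bound `c` on this difference, without
smallness, makes its tail small. First `r` is chosen to make the tail less than `ε/2`; with `r`
frozen, the flux difference is at most a constant times the `C¹` distance on `S_r`, which `δ` makes
less than `ε/2` (`exists_abs_mass_sub_lt`). All constants come from the model exterior region, so
`δ` does not depend on the manifold.

The divergence theorem on annuli (`flux_sub_flux`) is obtained by testing against radial cutoffs: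
integration by parts on `ℝⁿ` and polar coordinates identify the derivative of the flux almost
everywhere. -/

open Set Filter Topology MeasureTheory Manifold
open scoped ENNReal NNReal ContDiff

noncomputable section

namespace WeightedMass

/-! ### Smoothness of metrics and functions in coordinates. -/

section Components

variable {n : ℕ} {M : Type*} [TopologicalSpace M] [ChartedSpace (Euc n) M]
  [IsManifold (𝓡 n) ∞ M]

/-- A constant vector field is a smooth section of the tangent bundle of `ℝⁿ`. -/
theorem contMDiff_constVectorField (v : Euc n) :
    ContMDiff (𝓡 n) (𝓡 n).tangent ∞
      (fun x : Euc n => (⟨x, v⟩ : TangentBundle (𝓡 n) (Euc n))) := by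
  intro x
  refine (Bundle.contMDiffAt_section (E := (TangentSpace (𝓡 n) : Euc n → Type _))
    (s := fun _ => v) x).2 ?_
  simpa using contMDiffAt_const

/-- The field is the image of a constant field under the tangent map of `φ.symm`, which is smooth on
the open set `φ.target`. -/
theorem contMDiffOn_coordinateField (φ : OpenPartialHomeomorph M (Euc n))
    (hφ : φ ∈ IsManifold.maximalAtlas (𝓡 n) ∞ M) (v : Euc n) :
    ContMDiffOn (𝓡 n) (𝓡 n).tangent ∞
      (fun x : Euc n => (⟨φ.symm x, mfderiv (𝓡 n) (𝓡 n) φ.symm x v⟩ : TangentBundle (𝓡 n) M))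
      φ.target := by
  have h1 : ContMDiffOn (𝓡 n) (𝓡 n) ∞ φ.symm φ.target := contMDiffOn_symm_of_mem_maximalAtlas hφ
  have h2 := h1.contMDiffOn_tangentMapWithin (m := ∞) (by simp) φ.open_target.uniqueMDiffOn
  have h3 := h2.comp (contMDiff_constVectorField v).contMDiffOn (s := φ.target)
    (fun x hx => by simpa using hx)
  refine h3.congr fun x hx => ?_
  simp [tangentMapWithin, mfderivWithin_of_isOpen φ.open_target hx]

/-- A component is the smooth bilinear bundle section `g` evaluated on two smooth coordinate fields;
the values lie in a trivial line bundle, whose fibre coordinate is the component. -/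
theorem contDiffOn_components (g : RiemMetric n M) (φ : OpenPartialHomeomorph M (Euc n))
    (hφ : φ ∈ IsManifold.maximalAtlas (𝓡 n) ∞ M) (i j : Fin n) :
    ContDiffOn ℝ ∞ (fun x => components g φ x i j) φ.target := by
  rw [← contMDiffOn_iff_contDiffOn]
  intro x hx
  have h1 : ContMDiffOn (𝓡 n) (𝓡 n) ∞ φ.symm φ.target := contMDiffOn_symm_of_mem_maximalAtlas hφ
  have key := ContMDiffWithinAt.clm_bundle_apply₂ (IB := 𝓡 n) (IM := 𝓡 n) (n := ∞)
    (F₁ := Euc n) (F₂ := Euc n) (F₃ := ℝ) (E₃ := Bundle.Trivial M ℝ)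
    (E₁ := (TangentSpace (𝓡 n) : M → Type _)) (E₂ := (TangentSpace (𝓡 n) : M → Type _))
    (b := φ.symm) (s := φ.target) (x := x)
    (ψ := fun y => g.inner (φ.symm y))
    (ContMDiffAt.comp_contMDiffWithinAt x g.contMDiff.contMDiffAt (h1 x hx))
    (contMDiffOn_coordinateField φ hφ (EuclideanSpace.single i 1) x hx)
    (contMDiffOn_coordinateField φ hφ (EuclideanSpace.single j 1) x hx)
  rw [Bundle.contMDiffWithinAt_totalSpace] at key
  exact key.2

end Components

theorem contDiffOn_inChart {n : ℕ} {M : Type*} [TopologicalSpace M] [ChartedSpace (Euc n) M]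
    (f : M → ℝ) (hf : ContMDiff (𝓡 n) 𝓘(ℝ, ℝ) ∞ f)
    (φ : OpenPartialHomeomorph M (Euc n))
    (hφ : φ ∈ IsManifold.maximalAtlas (𝓡 n) ∞ M) :
    ContDiffOn ℝ ∞ (inChart f φ) φ.target := by
  rw [← contMDiffOn_iff_contDiffOn]
  have h1 : ContMDiffOn (𝓡 n) (𝓡 n) ∞ φ.symm φ.target := contMDiffOn_symm_of_mem_maximalAtlas hφ
  exact hf.comp_contMDiffOn h1

/-! ### Morrey's inequality on a ball. -/

section Morrey

open Metric

variable {n : ℕ}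

/-- Change of variables `y = x + ρ z`. Dilations are measurable embeddings, so `h` need not be
measurable. -/
theorem setLIntegral_ball_comp_add_smul (h : Euc n → ℝ≥0∞) (x : Euc n) {ρ : ℝ} (hρ : 0 < ρ) :
    ∫⁻ z in ball (0 : Euc n) 1, h (x + ρ • z) =
      ENNReal.ofReal (ρ ^ n)⁻¹ * ∫⁻ y in ball x ρ, h y := by
  have e1 : ∫⁻ z in ball (0 : Euc n) 1, h (x + ρ • z) =
      ∫⁻ z, (ball x ρ).indicator h (x + ρ • z) := by
    rw [← lintegral_indicator measurableSet_ball]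
    refine lintegral_congr fun z => ?_
    have : z ∈ ball (0 : Euc n) 1 ↔ x + ρ • z ∈ ball x ρ := by
      simp only [mem_ball, dist_zero_right, dist_self_add_left, norm_smul, Real.norm_eq_abs,
        abs_of_pos hρ]
      constructor <;> intro h <;> nlinarith
    by_cases hz : z ∈ ball (0 : Euc n) 1
    · rw [indicator_of_mem hz, indicator_of_mem (this.1 hz)]
    · rw [indicator_of_notMem hz, indicator_of_notMem (fun h => hz (this.2 h))]
  have e2 : ∫⁻ z, (ball x ρ).indicator h (x + ρ • z) =
      ∫⁻ z, (ball x ρ).indicator h (x + z) ∂(Measure.map (ρ • ·) (volume : Measure (Euc n))) := by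
    have hemb : MeasurableEmbedding (fun z : Euc n => ρ • z) :=
      measurableEmbedding_const_smul₀ hρ.ne'
    exact (hemb.lintegral_map (μ := volume) fun z => (ball x ρ).indicator h (x + z)).symm
  rw [e1, e2, Measure.map_addHaar_smul _ hρ.ne', lintegral_smul_measure,
    lintegral_add_left_eq_self, lintegral_indicator measurableSet_ball, smul_eq_mul,
    finrank_euclideanSpace_fin, abs_of_pos (by positivity)]

/-- The fundamental theorem of calculus along the segment from `x` to `x + R z`. The coordinates of
`z` are at most 1 in absolute value, so the directional derivative is dominated by the sum of the
partial derivatives. -/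
theorem enorm_le_add_lintegral_segment {x z : Euc n} {R : ℝ} (hR : 0 < R) {u : Euc n → ℝ}
    (hu : ContDiffOn ℝ 1 u (ball x R)) (hz : z ∈ ball (0 : Euc n) 1) :
    ‖u x‖ₑ ≤ ‖u (x + R • z)‖ₑ +
      ∫⁻ t in Ioc (0 : ℝ) 1, ENNReal.ofReal R * ∑ j, ‖pd j u (x + (t * R) • z)‖ₑ := by
  have hmem : ∀ t ∈ Icc (0 : ℝ) 1, x + (t * R) • z ∈ ball x R := by
    intro t ht
    simp only [mem_ball, dist_zero_right, dist_self_add_left, norm_smul, Real.norm_eq_abs,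
      abs_mul, abs_of_pos hR, abs_of_nonneg ht.1] at hz ⊢
    have : t * ‖z‖ < 1 := by nlinarith [ht.1, ht.2, norm_nonneg z]
    nlinarith
  have hd : ∀ y ∈ ball x R, HasFDerivAt u (fderiv ℝ u y) y := fun y hy =>
    ((hu.differentiableOn one_ne_zero).differentiableAt (isOpen_ball.mem_nhds hy)).hasFDerivAt
  have hderiv : ∀ t ∈ uIcc (0 : ℝ) 1, HasDerivAt (fun t : ℝ => u (x + (t * R) • z))
      (fderiv ℝ u (x + (t * R) • z) (R • z)) t := by
    intro t ht
    rw [uIcc_of_le zero_le_one] at ht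
    have h2 : HasDerivAt (fun t : ℝ => x + (t * R) • z) (R • z) t := by
      have := (((hasDerivAt_id t).mul_const R).smul_const z).const_add x
      simpa using this
    exact (hd _ (hmem t ht)).comp_hasDerivAt t h2
  have hcont : ContinuousOn (fun t : ℝ => fderiv ℝ u (x + (t * R) • z) (R • z)) (Icc 0 1) := by
    have h1 := hu.continuousOn_fderiv_of_isOpen isOpen_ball le_rfl
    exact (h1.comp (f := fun t : ℝ => x + (t * R) • z) (by fun_prop) hmem).clm_apply
      continuousOn_const
  have key := intervalIntegral.integral_eq_sub_of_hasDerivAt hderiv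
    (hcont.intervalIntegrable_of_Icc zero_le_one)
  simp only [one_mul, zero_mul, zero_smul, add_zero] at key
  rw [intervalIntegral.integral_of_le zero_le_one] at key
  have e : u x = u (x + R • z) - ∫ t in Ioc (0 : ℝ) 1, fderiv ℝ u (x + (t * R) • z) (R • z) := by
    rw [key]; ring
  rw [e]
  refine (enorm_sub_le).trans (add_le_add le_rfl ?_)
  refine (enorm_integral_le_lintegral_enorm _).trans (lintegral_mono fun t => ?_)
  have hz' : z = ∑ j, z j • (EuclideanSpace.single j (1 : ℝ) : Euc n) := by
    ext i
    simp [Finset.sum_apply, Pi.single_apply]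
  have e2 : fderiv ℝ u (x + (t * R) • z) (R • z) =
      ∑ j, R * (z j * pd j u (x + (t * R) • z)) := by
    conv_lhs => rw [map_smul, hz', map_sum, ← hz']
    simp [pd, Finset.mul_sum]
  rw [e2, Finset.mul_sum]
  refine (enorm_sum_le _ _).trans (Finset.sum_le_sum fun j _ => ?_)
  rw [enorm_mul, enorm_mul, Real.enorm_of_nonneg hR.le]
  gcongr
  have : ‖z j‖ ≤ 1 := (PiLp.norm_apply_le z j).trans (mem_ball_zero_iff.1 hz).le
  calc ‖z j‖ₑ * _ ≤ 1 * ‖pd j u (x + (t * R) • z)‖ₑ := by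
        gcongr
        rw [← ofReal_norm]
        simpa using this
    _ = _ := one_mul _

theorem measurable_pd (j : Fin n) (u : Euc n → ℝ) : Measurable (pd j u) :=
  measurable_fderiv_apply_const ℝ u _

theorem lintegral_lintegral_const_mul_sum {α β ι : Type*} [MeasurableSpace α] [MeasurableSpace β]
    [Fintype ι] {μ : Measure α} {ν : Measure β} [SFinite μ] [SFinite ν] {c : ℝ≥0∞} (hc : c ≠ ⊤)
    {k : ι → α × β → ℝ≥0∞} (hk : ∀ j, Measurable (k j)) :
    ∫⁻ z, ∫⁻ t, c * ∑ j, k j (z, t) ∂ν ∂μ = ∑ j, c * ∫⁻ t, ∫⁻ z, k j (z, t) ∂μ ∂ν := by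
  have hsum : Measurable (fun q : α × β => c * ∑ j, k j q) :=
    (Finset.measurable_sum _ fun j _ => hk j).const_mul _
  rw [lintegral_lintegral_swap (f := fun z t => c * ∑ j, k j (z, t)) hsum.aemeasurable,
    ← Finset.mul_sum, ← lintegral_finsetSum _ (fun j _ => (hk j).lintegral_prod_left'),
    ← lintegral_const_mul' _ _ hc]
  refine lintegral_congr fun t => ?_
  rw [lintegral_const_mul' _ _ hc, lintegral_finsetSum]
  exact fun j _ => (hk j).comp measurable_prodMk_right

/-- The segment estimate averaged over endpoints `z` in the unit ball; Tonelli puts the `z`-integral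
inside, where Hölder can be used at each `t`. -/
theorem volume_ball_mul_enorm_le {x : Euc n} {R : ℝ} (hR : 0 < R) {u : Euc n → ℝ}
    (hu : ContDiffOn ℝ 1 u (ball x R)) :
    volume (ball (0 : Euc n) 1) * ‖u x‖ₑ ≤
      (∫⁻ z in ball (0 : Euc n) 1, ‖u (x + R • z)‖ₑ) +
      ∑ j, ENNReal.ofReal R *
        ∫⁻ t in Ioc (0 : ℝ) 1, ∫⁻ z in ball (0 : Euc n) 1, ‖pd j u (x + (t * R) • z)‖ₑ := by
  have hm : ∀ j, Measurable (fun q : Euc n × ℝ => ‖pd j u (x + (q.2 * R) • q.1)‖ₑ) := fun j =>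
    ((measurable_pd j u).comp (g := pd j u) (f := fun q : Euc n × ℝ => x + (q.2 * R) • q.1)
      (by fun_prop)).enorm
  have hsum : Measurable (fun q : Euc n × ℝ =>
      ENNReal.ofReal R * ∑ j, ‖pd j u (x + (q.2 * R) • q.1)‖ₑ) :=
    (Finset.measurable_sum _ fun j _ => hm j).const_mul _
  calc volume (ball (0 : Euc n) 1) * ‖u x‖ₑ = ∫⁻ z in ball (0 : Euc n) 1, ‖u x‖ₑ := by
        rw [setLIntegral_const, mul_comm]
    _ ≤ ∫⁻ z in ball (0 : Euc n) 1, (‖u (x + R • z)‖ₑ +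
          ∫⁻ t in Ioc (0 : ℝ) 1, ENNReal.ofReal R * ∑ j, ‖pd j u (x + (t * R) • z)‖ₑ) :=
        setLIntegral_mono' measurableSet_ball fun z hz => enorm_le_add_lintegral_segment hR hu hz
    _ = _ := by
        rw [lintegral_add_right _ hsum.lintegral_prod_right',
          lintegral_lintegral_const_mul_sum ENNReal.ofReal_ne_top hm]

/-- Hölder on the small ball, with `(ρⁿ)⁻¹ (ρⁿ)^{1-1/p} = ρ^{-n/p}`. The `L^p` norm is taken on the
larger fixed ball, so that for `ρ = tR` the only dependence on `t` is the factor `t^{-n/p}`. -/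
theorem setLIntegral_comp_add_smul_le {p : ℝ} (hp : 1 < p) {x : Euc n} {ρ R : ℝ} (hρ : 0 < ρ)
    (hρR : ρ ≤ R) {h : Euc n → ℝ≥0∞} (hm : AEMeasurable h (volume.restrict (ball x R))) :
    ∫⁻ z in ball (0 : Euc n) 1, h (x + ρ • z) ≤
      volume (ball (0 : Euc n) 1) ^ (1 - 1 / p) * ENNReal.ofReal (ρ ^ (-(n / p : ℝ))) *
        (∫⁻ y in ball x R, h y ^ p) ^ (1 / p) := by
  have hp0 : 0 < p := by linarith
  have hq := Real.HolderConjugate.conjExponent hp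
  set q := p.conjExponent
  have hq1 : 1 / q = 1 - 1 / p := by have := hq.inv_add_inv_eq_one; simp only [one_div]; linarith
  have hsub : ball x ρ ⊆ ball x R := ball_subset_ball hρR
  have hn : 0 < ρ ^ n := by positivity
  calc ∫⁻ z in ball (0 : Euc n) 1, h (x + ρ • z)
      = ENNReal.ofReal (ρ ^ n)⁻¹ * ∫⁻ y in ball x ρ, h y * 1 := by
        rw [setLIntegral_ball_comp_add_smul h x hρ]; simp
    _ ≤ ENNReal.ofReal (ρ ^ n)⁻¹ * ((∫⁻ y in ball x ρ, h y ^ p) ^ (1 / p) *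
          (∫⁻ y in ball x ρ, (1 : ℝ≥0∞) ^ q) ^ (1 / q)) := by
        gcongr
        exact ENNReal.lintegral_mul_le_Lp_mul_Lq _ hq
          (hm.mono_measure (Measure.restrict_mono hsub le_rfl)) aemeasurable_const
    _ ≤ ENNReal.ofReal (ρ ^ n)⁻¹ * ((∫⁻ y in ball x R, h y ^ p) ^ (1 / p) *
          (ENNReal.ofReal (ρ ^ n) * volume (ball (0 : Euc n) 1)) ^ (1 - 1 / p)) := by
        rw [hq1]
        gcongr
        · rw [sub_nonneg, div_le_one hp0]; exact hp.le
        · simp only [ENNReal.one_rpow, setLIntegral_const, one_mul]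
          rw [Measure.addHaar_ball_of_pos volume x hρ, finrank_euclideanSpace_fin]
    _ = _ := by
        rw [ENNReal.mul_rpow_of_ne_top ENNReal.ofReal_ne_top measure_ball_lt_top.ne,
          ENNReal.ofReal_rpow_of_pos hn]
        have : ENNReal.ofReal (ρ ^ (-(n / p : ℝ))) =
            ENNReal.ofReal (ρ ^ n)⁻¹ * ENNReal.ofReal ((ρ ^ n) ^ (1 - 1 / p)) := by
          rw [← ENNReal.ofReal_mul (by positivity)]
          congr 1
          rw [← Real.rpow_natCast, ← Real.rpow_neg hρ.le, ← Real.rpow_mul hρ.le,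
            ← Real.rpow_add hρ]
          congr 1
          ring
        rw [this]
        ring

end Morrey

/-! ### The weighted Sobolev embedding on the exterior region. -/

section WeightedMorrey

open Metric

variable {n : ℕ}

theorem rpow_le_two_rpow_abs_mul_rpow {a b : ℝ} (ha : 0 < a) (hab : a / 2 ≤ b) (hba : b ≤ 2 * a)
    (e : ℝ) : a ^ e ≤ 2 ^ |e| * b ^ e := by
  have hb : 0 < b := by linarith
  rcases le_total 0 e with he | he
  · rw [abs_of_nonneg he, ← Real.mul_rpow (by norm_num) hb.le]
    exact Real.rpow_le_rpow ha.le (by linarith) he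
  · rw [abs_of_nonpos he, Real.rpow_neg (by norm_num), ← Real.inv_rpow (by norm_num),
      ← Real.mul_rpow (by norm_num) hb.le]
    exact Real.rpow_le_rpow_of_nonpos (by positivity) (by linarith) he

theorem measurable_ofReal_norm_rpow (e : ℝ) :
    Measurable (fun x : Euc n => ENNReal.ofReal (‖x‖ ^ e)) :=
  (measurable_norm.pow_const e).ennreal_ofReal

theorem lintegral_scaleMeasure (h : Euc n → ℝ≥0∞) :
    ∫⁻ y, h y ∂scaleMeasure n =
      ∫⁻ y in exterior n, ENNReal.ofReal (‖y‖ ^ (-(n : ℝ))) * h y := by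
  rw [scaleMeasure, lintegral_withDensity_eq_lintegral_mul_non_measurable _
    (measurable_ofReal_norm_rpow _) (ae_of_all _ fun _ => ENNReal.ofReal_lt_top)]
  rfl

theorem isOpen_exterior : IsOpen (exterior n) := isOpen_lt continuous_const continuous_norm

theorem half_norm_le_and_le_of_mem_ball {x y : Euc n} (hx : 2 ≤ ‖x‖)
    (hy : y ∈ ball x (‖x‖ / 2)) : ‖x‖ / 2 ≤ ‖y‖ ∧ ‖y‖ ≤ 2 * ‖x‖ ∧ y ∈ exterior n := by
  rw [mem_ball, dist_eq_norm] at hy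
  have h1 : ‖x‖ ≤ ‖y‖ + ‖y - x‖ := by
    have := norm_sub_le y (y - x); simpa using this
  have h2 : ‖y‖ ≤ ‖x‖ + ‖y - x‖ := by
    have := norm_add_le x (y - x); simpa using this
  refine ⟨by linarith, by linarith, ?_⟩
  change 1 < ‖y‖
  linarith

/-- On the ball of radius `‖x‖ / 2` about `x` one has `‖x‖ / 2 ≤ ‖y‖ ≤ 2 ‖x‖`, so the weights are
constant up to a fixed factor and an unweighted local norm costs one power of `‖x‖`. -/
theorem lintegral_ball_rpow_le {p : ℝ} (hp : 0 < p) (q : ℝ) {v : Euc n → ℝ} {x : Euc n}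
    (hx : 2 ≤ ‖x‖) :
    (∫⁻ y in ball x (‖x‖ / 2), ‖v y‖ₑ ^ p) ^ (1 / p) ≤
      ENNReal.ofReal (2 ^ |q - n / p| * ‖x‖ ^ (n / p - q)) *
        eLpNorm (fun y => v y * ‖y‖ ^ q) (ENNReal.ofReal p) (scaleMeasure n) := by
  have hx0 : 0 < ‖x‖ := by linarith
  set c : ℝ := 2 ^ |q - n / p| * ‖x‖ ^ (n / p - q) with hc
  have hc0 : 0 < c := by positivity
  rw [eLpNorm_eq_lintegral_rpow_enorm_toReal (by simpa using hp) ENNReal.ofReal_ne_top,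
    ENNReal.toReal_ofReal hp.le, lintegral_scaleMeasure]
  have key : ∀ y ∈ ball x (‖x‖ / 2), ‖v y‖ₑ ^ p ≤ ENNReal.ofReal (c ^ p) *
      (ENNReal.ofReal (‖y‖ ^ (-(n : ℝ))) * ‖v y * ‖y‖ ^ q‖ₑ ^ p) := by
    intro y hy
    obtain ⟨h1, h2, -⟩ := half_norm_le_and_le_of_mem_ball hx hy
    have hy0 : 0 < ‖y‖ := by linarith
    have h3 : 1 ≤ c * ‖y‖ ^ (q - n / p) := by
      have := rpow_le_two_rpow_abs_mul_rpow hx0 h1 h2 (q - n / p)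
      have e1 : ‖x‖ ^ (n / p - q) * ‖x‖ ^ (q - n / p) = 1 := by
        rw [← Real.rpow_add hx0]; simp
      calc (1 : ℝ) = ‖x‖ ^ (n / p - q) * ‖x‖ ^ (q - n / p) := e1.symm
        _ ≤ ‖x‖ ^ (n / p - q) * (2 ^ |q - n / p| * ‖y‖ ^ (q - n / p)) := by gcongr
        _ = _ := by rw [hc]; ring
    have h4 : c ^ p * (‖y‖ ^ (-(n : ℝ)) * (‖y‖ ^ q) ^ p) = (c * ‖y‖ ^ (q - n / p)) ^ p := by
      rw [Real.mul_rpow hc0.le (by positivity), ← Real.rpow_mul hy0.le, ← Real.rpow_mul hy0.le,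
        ← Real.rpow_add hy0]
      congr 2
      field_simp
      ring
    rw [enorm_mul, ENNReal.mul_rpow_of_nonneg _ _ hp.le,
      Real.enorm_of_nonneg (show 0 ≤ ‖y‖ ^ q by positivity),
      ENNReal.ofReal_rpow_of_nonneg (by positivity) hp.le]
    calc ‖v y‖ₑ ^ p = 1 * ‖v y‖ₑ ^ p := (one_mul _).symm
      _ ≤ ENNReal.ofReal (c ^ p * (‖y‖ ^ (-(n : ℝ)) * (‖y‖ ^ q) ^ p)) * ‖v y‖ₑ ^ p := by
          gcongr
          rw [h4, ENNReal.one_le_ofReal]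
          exact Real.one_le_rpow h3 hp.le
      _ = _ := by
          rw [ENNReal.ofReal_mul (by positivity), ENNReal.ofReal_mul (by positivity)]
          ring
  have hsub : ball x (‖x‖ / 2) ⊆ exterior n := fun y hy =>
    (half_norm_le_and_le_of_mem_ball hx hy).2.2
  calc (∫⁻ y in ball x (‖x‖ / 2), ‖v y‖ₑ ^ p) ^ (1 / p)
      ≤ (ENNReal.ofReal (c ^ p) * ∫⁻ y in exterior n,
          ENNReal.ofReal (‖y‖ ^ (-(n : ℝ))) * ‖v y * ‖y‖ ^ q‖ₑ ^ p) ^ (1 / p) := by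
        gcongr
        rw [← lintegral_const_mul' _ _ ENNReal.ofReal_ne_top]
        exact (setLIntegral_mono' measurableSet_ball key).trans (lintegral_mono_set hsub)
    _ = _ := by
        rw [ENNReal.mul_rpow_of_nonneg _ _ (by positivity),
          ENNReal.ofReal_rpow_of_nonneg (by positivity) (by positivity), ← Real.rpow_mul hc0.le]
        simp [hp.ne']

/-- The weighted Sobolev embedding `W^{1,p}_s ⊆ L^∞_s` for `p > n`. -/
theorem exists_enorm_le_of_weighted_sobolev (hn : 1 ≤ n) {p : ℝ} (hp : (n : ℝ) < p) (s : ℝ) :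
    ∃ C : ℝ≥0∞, C ≠ ⊤ ∧ ∀ (u : Euc n → ℝ) (N : ℝ≥0∞), ContDiffOn ℝ 1 u (exterior n) →
      eLpNorm (fun y => u y * ‖y‖ ^ (-s)) (ENNReal.ofReal p) (scaleMeasure n) ≤ N →
      (∀ j, eLpNorm (fun y => pd j u y * ‖y‖ ^ (1 - s)) (ENNReal.ofReal p) (scaleMeasure n) ≤ N) →
      ∀ x, 2 ≤ ‖x‖ → ‖u x‖ₑ ≤ C * ENNReal.ofReal (‖x‖ ^ s) * N := by
  have hn' : (1 : ℝ) ≤ n := by exact_mod_cast hn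
  have hp1 : 1 < p := by linarith
  have hp0 : 0 < p := by linarith
  set V : ℝ≥0∞ := volume (ball (0 : Euc n) 1) with hV
  have hV0 : V ≠ 0 := (measure_ball_pos _ _ one_pos).ne'
  have hVt : V ≠ ⊤ := measure_ball_lt_top.ne
  set I : ℝ≥0∞ := ∫⁻ t in Ioc (0 : ℝ) 1, ENNReal.ofReal (t ^ (-(n / p : ℝ))) with hI
  have hIt : I ≠ ⊤ := by
    -- Here `p > n` is essential: the singularity `t^{-n/p}` left by Hölder is integrable on `(0,
    -- 1]`.
    have hlt : -1 < -(n / p : ℝ) := by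
      rw [neg_lt_neg_iff, div_lt_one hp0]; exact hp
    have := (intervalIntegral.intervalIntegrable_rpow' (a := 0) (b := 1) hlt)
    rw [intervalIntegrable_iff_integrableOn_Ioc_of_le zero_le_one] at this
    refine ne_of_lt ?_
    refine lt_of_le_of_lt ?_ this.2
    exact setLIntegral_mono' measurableSet_Ioc fun t ht => Real.ofReal_le_enorm _
  set D : ℝ≥0∞ := ENNReal.ofReal (2 ^ (n / p : ℝ)) * ENNReal.ofReal (2 ^ |-s - n / p|) +
    n * (I * ENNReal.ofReal (2 ^ (n / p : ℝ)) * ENNReal.ofReal (2 ^ |1 - s - n / p|)) with hD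
  have hDt : D ≠ ⊤ := by
    rw [hD]
    finiteness
  refine ⟨V⁻¹ * (V ^ (1 - 1 / p) * D), ?_, ?_⟩
  · have : V ^ (1 - 1 / p) ≠ ⊤ := ENNReal.rpow_ne_top_of_nonneg
      (by rw [sub_nonneg, div_le_one hp0]; exact hp1.le) hVt
    finiteness
  intro u N hu hN0 hN1 x hx
  have hx0 : 0 < ‖x‖ := by linarith
  -- The radius is proportional to `‖x‖`, so that the local inequality is scale invariant and the
  -- constant does not depend on `x`.
  set R := ‖x‖ / 2 with hR
  have hR0 : 0 < R := by positivity
  have hsub : ball x R ⊆ exterior n := fun y hy =>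
    (half_norm_le_and_le_of_mem_ball hx hy).2.2
  have hu' : ContDiffOn ℝ 1 u (ball x R) := hu.mono hsub
  have h1 := volume_ball_mul_enorm_le hR0 hu'
  have hRpow : R ^ (-(n / p : ℝ)) = 2 ^ (n / p : ℝ) * ‖x‖ ^ (-(n / p : ℝ)) := by
    rw [hR, Real.div_rpow hx0.le (by norm_num), Real.rpow_neg (by norm_num : (0 : ℝ) ≤ 2)]
    field_simp
  have hA : ∫⁻ z in ball (0 : Euc n) 1, ‖u (x + R • z)‖ₑ ≤ V ^ (1 - 1 / p) *
      (ENNReal.ofReal (2 ^ (n / p : ℝ)) * ENNReal.ofReal (2 ^ |-s - n / p|)) *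
        ENNReal.ofReal (‖x‖ ^ s) * N := by
    refine (setLIntegral_comp_add_smul_le hp1 hR0 le_rfl (h := fun y => ‖u y‖ₑ)
      (hu'.continuousOn.aemeasurable measurableSet_ball).enorm).trans ?_
    refine (mul_le_mul_right (lintegral_ball_rpow_le hp0 (-s) hx) _).trans ?_
    refine (mul_le_mul_right (mul_le_mul_right hN0 _) _).trans ?_
    rw [hRpow, ENNReal.ofReal_mul (by positivity), ENNReal.ofReal_mul (by positivity)]
    have : ENNReal.ofReal (‖x‖ ^ s) = ENNReal.ofReal (‖x‖ ^ (-(n / p : ℝ))) *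
        ENNReal.ofReal (‖x‖ ^ (n / p - -s)) := by
      rw [← ENNReal.ofReal_mul (by positivity), ← Real.rpow_add hx0]
      congr 2; ring
    rw [this]
    apply le_of_eq
    ring
  have hB : ∀ j, ENNReal.ofReal R *
        ∫⁻ t in Ioc (0 : ℝ) 1, ∫⁻ z in ball (0 : Euc n) 1, ‖pd j u (x + (t * R) • z)‖ₑ ≤
      V ^ (1 - 1 / p) * (I * ENNReal.ofReal (2 ^ (n / p : ℝ)) *
        ENNReal.ofReal (2 ^ |1 - s - n / p|)) * ENNReal.ofReal (‖x‖ ^ s) * N := by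
    intro j
    have h2 : ∀ t ∈ Ioc (0 : ℝ) 1,
        ∫⁻ z in ball (0 : Euc n) 1, ‖pd j u (x + (t * R) • z)‖ₑ ≤
          ENNReal.ofReal (t ^ (-(n / p : ℝ))) * (V ^ (1 - 1 / p) *
            ENNReal.ofReal (R ^ (-(n / p : ℝ))) *
            (ENNReal.ofReal (2 ^ |1 - s - n / p| * ‖x‖ ^ (n / p - (1 - s))) * N)) := by
      intro t ht
      refine (setLIntegral_comp_add_smul_le hp1 (mul_pos ht.1 hR0)
        (mul_le_of_le_one_left hR0.le ht.2) (h := fun y => ‖pd j u y‖ₑ)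
        (measurable_pd j u).enorm.aemeasurable).trans ?_
      refine (mul_le_mul_right (lintegral_ball_rpow_le hp0 (1 - s) hx) _).trans ?_
      refine (mul_le_mul_right (mul_le_mul_right (hN1 j) _) _).trans ?_
      rw [Real.mul_rpow ht.1.le hR0.le, ENNReal.ofReal_mul (Real.rpow_nonneg ht.1.le _)]
      apply le_of_eq
      ring
    refine (mul_le_mul_right (setLIntegral_mono' measurableSet_Ioc h2) _).trans ?_
    rw [lintegral_mul_const, ← hI]
    swap
    · fun_prop
    -- The powers of `‖x‖` come from the length of the segment, from Hölder, and from the change of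
    -- weight: `1 - n/p + (n/p - (1 - s)) = s`.
    have e : ENNReal.ofReal (‖x‖ ^ s) = ENNReal.ofReal ‖x‖ * ENNReal.ofReal (‖x‖ ^ (-(n / p : ℝ))) *
        ENNReal.ofReal (‖x‖ ^ (n / p - (1 - s))) := by
      rw [← ENNReal.ofReal_mul (by positivity), ← ENNReal.ofReal_mul (by positivity)]
      congr 1
      nth_rw 2 [← Real.rpow_one ‖x‖]
      rw [← Real.rpow_add hx0, ← Real.rpow_add hx0]
      congr 1; ring
    rw [hRpow, ENNReal.ofReal_mul (by positivity), ENNReal.ofReal_mul (by positivity), e]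
    have hRx : ENNReal.ofReal R ≤ ENNReal.ofReal ‖x‖ :=
      ENNReal.ofReal_le_ofReal (by rw [hR]; linarith)
    refine (mul_le_mul_left hRx _).trans (le_of_eq ?_)
    ring
  have h3 : V * ‖u x‖ₑ ≤ V ^ (1 - 1 / p) * D * ENNReal.ofReal (‖x‖ ^ s) * N := by
    refine h1.trans ((add_le_add hA (Finset.sum_le_sum fun j _ => hB j)).trans (le_of_eq ?_))
    rw [Finset.sum_const, Finset.card_univ, Fintype.card_fin, nsmul_eq_mul, hD]
    ring
  calc ‖u x‖ₑ = V⁻¹ * (V * ‖u x‖ₑ) := by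
        rw [← mul_assoc, ENNReal.inv_mul_cancel hV0 hVt, one_mul]
    _ ≤ V⁻¹ * (V ^ (1 - 1 / p) * D * ENNReal.ofReal (‖x‖ ^ s) * N) := by gcongr
    _ = _ := by ring

end WeightedMorrey

/-! ### Decay of functions in the weighted space. -/

section Decay

variable {n : ℕ}

theorem contDiffOn_pd {U : Set (Euc n)} (hU : IsOpen U) {u : Euc n → ℝ} (hu : ContDiffOn ℝ ∞ u U)
    (i : Fin n) : ContDiffOn ℝ ∞ (pd i u) U :=
  (hu.fderiv_of_isOpen hU (m := ∞) (by simp)).clm_apply contDiffOn_const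

theorem pd_comm {U : Set (Euc n)} (hU : IsOpen U) {u : Euc n → ℝ} (hu : ContDiffOn ℝ ∞ u U)
    (i j : Fin n) {x : Euc n} (hx : x ∈ U) : pd i (pd j u) x = pd j (pd i u) x := by
  have hux : ContDiffAt ℝ ∞ u x := hu.contDiffAt (hU.mem_nhds hx)
  have hd : DifferentiableAt ℝ (fderiv ℝ u) x :=
    ((hux.fderiv_right (m := 1) (by norm_cast)).differentiableAt one_ne_zero)
  have hsymm : IsSymmSndFDerivAt ℝ u x := hux.isSymmSndFDerivAt (by simp; norm_cast)
  have e : ∀ i j : Fin n, pd i (pd j u) x =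
      fderiv ℝ (fderiv ℝ u) x (EuclideanSpace.single i 1) (EuclideanSpace.single j 1) := by
    intro i j
    have : HasFDerivAt (pd j u) ((fderiv ℝ (fderiv ℝ u) x).flip (EuclideanSpace.single j 1)) x := by
      simpa [pd] using! hd.hasFDerivAt.clm_apply
        (hasFDerivAt_const (EuclideanSpace.single j (1 : ℝ) : Euc n) x)
    rw [pd, this.fderiv]
    rfl
  rw [e, e]
  exact hsymm _ _

/-- Outside the unit ball `1 + ‖x‖ ≤ 2 ‖x‖`, so the integrand is dominated by the integrable
function `2^e (1 + ‖x‖)^{-e}`. -/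
theorem lintegral_exterior_rpow_lt_top {e : ℝ} (he : (n : ℝ) < e) :
    ∫⁻ x in exterior n, ENNReal.ofReal (‖x‖ ^ (-e)) < ⊤ := by
  have he0 : 0 < e := lt_of_le_of_lt n.cast_nonneg he
  have h := finite_integral_one_add_norm (E := Euc n) (μ := volume) (r := e)
    (by simpa using he)
  calc ∫⁻ x in exterior n, ENNReal.ofReal (‖x‖ ^ (-e))
      ≤ ∫⁻ x in exterior n, ENNReal.ofReal (2 ^ e) * ENNReal.ofReal ((1 + ‖x‖) ^ (-e)) := by
        refine setLIntegral_mono' isOpen_exterior.measurableSet fun x hx => ?_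
        have hx1 : 1 < ‖x‖ := hx
        rw [← ENNReal.ofReal_mul (by positivity)]
        refine ENNReal.ofReal_le_ofReal ?_
        have h2 : (2 : ℝ) ^ e = (1 / 2 : ℝ) ^ (-e) := by
          rw [one_div, Real.inv_rpow (by norm_num), Real.rpow_neg (by norm_num), inv_inv]
        rw [h2, ← Real.mul_rpow (by norm_num) (by positivity)]
        exact Real.rpow_le_rpow_of_nonpos (by positivity) (by linarith) (by linarith)
    _ ≤ ENNReal.ofReal (2 ^ e) * ∫⁻ x : Euc n, ENNReal.ofReal ((1 + ‖x‖) ^ (-e)) := by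
        rw [lintegral_const_mul' _ _ ENNReal.ofReal_ne_top]
        gcongr
        exact Measure.restrict_le_self
    _ < ⊤ := ENNReal.mul_lt_top ENNReal.ofReal_lt_top h

/-- Hölder's inequality for the scale-invariant norm, against a power that decays. -/
theorem exists_lintegral_rpow_mul_le {p : ℝ} (hp : 1 < p) {κ : ℝ} (hκ : 0 < κ) :
    ∃ C : ℝ≥0∞, C ≠ ⊤ ∧ ∀ (w : Euc n → ℝ) (q : ℝ), Measurable w →
      ∫⁻ x in exterior n, ENNReal.ofReal (‖x‖ ^ (q - n - κ)) * ‖w x‖ₑ ≤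
        C * eLpNorm (fun x => w x * ‖x‖ ^ q) (ENNReal.ofReal p) (scaleMeasure n) := by
  have hp0 : 0 < p := by linarith
  have hq := Real.HolderConjugate.conjExponent hp
  set p' := p.conjExponent
  have hp' : 0 < p' := hq.symm.pos
  -- The integral of `(|x|^{-κ})^{p'}` against `|x|^{-n} dx`; it is finite because `κ > 0`.
  set J : ℝ≥0∞ := ∫⁻ x in exterior n, ENNReal.ofReal (‖x‖ ^ (-(n + κ * p')))
  have hJ : J < ⊤ := lintegral_exterior_rpow_lt_top (by nlinarith)
  refine ⟨J ^ (1 / p'), ENNReal.rpow_ne_top_of_nonneg (by positivity) hJ.ne, fun w q hw => ?_⟩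
  have e1 : ∫⁻ x in exterior n, ENNReal.ofReal (‖x‖ ^ (q - n - κ)) * ‖w x‖ₑ =
      ∫⁻ x, ((fun x => ‖w x * ‖x‖ ^ q‖ₑ) * (fun x => ENNReal.ofReal (‖x‖ ^ (-κ))) :
        Euc n → ℝ≥0∞) x
        ∂scaleMeasure n := by
    rw [lintegral_scaleMeasure]
    refine setLIntegral_congr_fun isOpen_exterior.measurableSet fun x hx => ?_
    have hx0 : 0 < ‖x‖ := lt_trans one_pos hx
    simp only [Pi.mul_apply]
    rw [enorm_mul, Real.enorm_of_nonneg (show 0 ≤ ‖x‖ ^ q by positivity)]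
    have : ENNReal.ofReal (‖x‖ ^ (q - n - κ)) = ENNReal.ofReal (‖x‖ ^ (-(n : ℝ))) *
        (ENNReal.ofReal (‖x‖ ^ q) * ENNReal.ofReal (‖x‖ ^ (-κ))) := by
      rw [← ENNReal.ofReal_mul (by positivity), ← ENNReal.ofReal_mul (by positivity),
        ← Real.rpow_add hx0, ← Real.rpow_add hx0]
      congr 2; ring
    rw [this]
    ring
  have e2 : ∫⁻ x, ENNReal.ofReal (‖x‖ ^ (-κ)) ^ p' ∂scaleMeasure n = J := by
    rw [lintegral_scaleMeasure]
    refine setLIntegral_congr_fun isOpen_exterior.measurableSet fun x hx => ?_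
    have hx0 : 0 < ‖x‖ := lt_trans one_pos hx
    rw [ENNReal.ofReal_rpow_of_pos (by positivity), ← ENNReal.ofReal_mul (by positivity),
      ← Real.rpow_mul hx0.le, ← Real.rpow_add hx0]
    congr 2; ring
  rw [e1]
  refine (ENNReal.lintegral_mul_le_Lp_mul_Lq _ hq ?_ ?_).trans (le_of_eq ?_)
  · exact (hw.mul (measurable_norm.pow_const q)).enorm.aemeasurable
  · exact (measurable_ofReal_norm_rpow _).aemeasurable
  · rw [e2, eLpNorm_eq_lintegral_rpow_enorm_toReal (by simpa using hp0) ENNReal.ofReal_ne_top,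
      ENNReal.toReal_ofReal hp0.le, mul_comm]

/-- The bounds for a function of `W^{2,p}_{-τ}`, `p > n`, that the mass estimate uses:
pointwise decay of the function and of its gradient, and integrability of the second
derivatives against `|x|^{1 - n/2}`. -/
structure DecayBound (τ K : ℝ) (u : Euc n → ℝ) : Prop where
  smooth : ContDiffOn ℝ ∞ u (exterior n)
  abs_le : ∀ x, 2 ≤ ‖x‖ → |u x| ≤ K * ‖x‖ ^ (-τ)
  abs_pd_le : ∀ i x, 2 ≤ ‖x‖ → |pd i u x| ≤ K * ‖x‖ ^ (-τ - 1)
  lintegral_pd_pd_le : ∀ i j,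
    ∫⁻ x in exterior n, ENNReal.ofReal (‖x‖ ^ (1 - n / 2 : ℝ)) * ‖pd i (pd j u) x‖ₑ ≤
      ENNReal.ofReal K

theorem pd_add {u v : Euc n → ℝ} {x : Euc n} (hu : DifferentiableAt ℝ u x)
    (hv : DifferentiableAt ℝ v x) (i : Fin n) :
    pd i (fun y => u y + v y) x = pd i u x + pd i v x := by
  rw [pd, fderiv_fun_add hu hv]; rfl

theorem pd_congr_of_eventuallyEq {u v : Euc n → ℝ} {x : Euc n} (h : u =ᶠ[𝓝 x] v) (i : Fin n) :
    pd i u x = pd i v x := by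
  rw [pd, h.fderiv_eq]; rfl

theorem differentiableAt_of_contDiffOn {U : Set (Euc n)} (hU : IsOpen U) {u : Euc n → ℝ}
    (hu : ContDiffOn ℝ ∞ u U) {x : Euc n} (hx : x ∈ U) : DifferentiableAt ℝ u x :=
  (hu.differentiableOn (by simp)).differentiableAt (hU.mem_nhds hx)

theorem pd_pd_add {U : Set (Euc n)} (hU : IsOpen U) {u v : Euc n → ℝ} (hu : ContDiffOn ℝ ∞ u U)
    (hv : ContDiffOn ℝ ∞ v U) (i j : Fin n) {x : Euc n} (hx : x ∈ U) :
    pd i (pd j fun y => u y + v y) x = pd i (pd j u) x + pd i (pd j v) x := by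
  have : pd j (fun y => u y + v y) =ᶠ[𝓝 x] fun y => pd j u y + pd j v y :=
    eventually_of_mem (hU.mem_nhds hx) fun y hy => pd_add
      (differentiableAt_of_contDiffOn hU hu hy) (differentiableAt_of_contDiffOn hU hv hy) j
  rw [pd_congr_of_eventuallyEq this, pd_add
    (differentiableAt_of_contDiffOn hU (contDiffOn_pd hU hu j) hx)
    (differentiableAt_of_contDiffOn hU (contDiffOn_pd hU hv j) hx)]

theorem mem_exterior_of_two_le {x : Euc n} (hx : 2 ≤ ‖x‖) : x ∈ exterior n :=
  lt_of_lt_of_le one_lt_two hx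

theorem DecayBound.add {τ K K' : ℝ} (hK : 0 ≤ K) (hK' : 0 ≤ K') {u v : Euc n → ℝ}
    (hu : DecayBound τ K u) (hv : DecayBound τ K' v) :
    DecayBound τ (K + K') fun x => u x + v x where
  smooth := hu.smooth.add hv.smooth
  abs_le x hx := by
    have := hu.abs_le x hx
    have := hv.abs_le x hx
    have := abs_add_le (u x) (v x)
    linarith
  abs_pd_le i x hx := by
    have hx' := mem_exterior_of_two_le hx
    rw [pd_add (differentiableAt_of_contDiffOn isOpen_exterior hu.smooth hx')
      (differentiableAt_of_contDiffOn isOpen_exterior hv.smooth hx')]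
    have := hu.abs_pd_le i x hx
    have := hv.abs_pd_le i x hx
    have := abs_add_le (pd i u x) (pd i v x)
    linarith
  lintegral_pd_pd_le i j := by
    rw [ENNReal.ofReal_add hK hK']
    refine le_trans ?_ (add_le_add (hu.lintegral_pd_pd_le i j) (hv.lintegral_pd_pd_le i j))
    rw [← lintegral_add_left]
    swap
    · exact (measurable_ofReal_norm_rpow _).mul (measurable_pd i _).enorm
    refine setLIntegral_mono' isOpen_exterior.measurableSet fun x hx => ?_
    rw [pd_pd_add isOpen_exterior hu.smooth hv.smooth i j hx, ← mul_add]
    gcongr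
    exact enorm_add_le _ _

theorem DecayBound.mono {τ K K' : ℝ} (hK : K ≤ K') {u : Euc n → ℝ} (hu : DecayBound τ K u) :
    DecayBound τ K' u where
  smooth := hu.smooth
  abs_le x hx := (hu.abs_le x hx).trans (by gcongr)
  abs_pd_le i x hx := (hu.abs_pd_le i x hx).trans (by gcongr)
  lintegral_pd_pd_le i j := (hu.lintegral_pd_pd_le i j).trans (ENNReal.ofReal_le_ofReal hK)

theorem eLpNorm_pdList_le_weightedNorm {k m : ℕ} (hm : m ≤ k) {I : Fin m → Fin n}
    (hI : Monotone I) (p : ℝ≥0∞) (s : ℝ) (u : Euc n → ℝ) :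
    eLpNorm (fun x => pdList (List.ofFn I) u x * ‖x‖ ^ ((m : ℝ) - s)) p (scaleMeasure n) ≤
      weightedNorm k p s u := by
  rw [weightedNorm]
  refine le_trans ?_ (Finset.single_le_sum (f := fun m => ∑ I ∈ multiIndices n m,
    eLpNorm (fun x => pdList (List.ofFn I) u x * ‖x‖ ^ ((m : ℝ) - s)) p (scaleMeasure n))
    (fun _ _ => zero_le) (Finset.mem_range.2 (Nat.lt_succ_of_le hm)))
  exact Finset.single_le_sum (f := fun I => eLpNorm
    (fun x => pdList (List.ofFn I) u x * ‖x‖ ^ ((m : ℝ) - s)) p (scaleMeasure n))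
    (fun _ _ => zero_le) (by simp [multiIndices, hI])

theorem ae_scaleMeasure_of_forall_mem {P : Euc n → Prop} (h : ∀ x ∈ exterior n, P x) :
    ∀ᵐ x ∂scaleMeasure n, P x :=
  (withDensity_absolutelyContinuous _ _).ae_le
    (ae_restrict_of_forall_mem isOpen_exterior.measurableSet h)

/-- The norm only contains the derivatives along nondecreasing words; the opposite order is
recovered from the symmetry of second derivatives. -/
theorem eLpNorm_pd_pd_le_weightedNorm {u : Euc n → ℝ} (hu : ContDiffOn ℝ ∞ u (exterior n))
    (p : ℝ≥0∞) (s : ℝ) (i j : Fin n) :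
    eLpNorm (fun x => pd i (pd j u) x * ‖x‖ ^ (2 - s)) p (scaleMeasure n) ≤
      weightedNorm 2 p s u := by
  wlog hij : i ≤ j generalizing i j
  · refine le_trans (le_of_eq ?_) (this j i (le_of_not_ge hij))
    refine eLpNorm_congr_ae (ae_scaleMeasure_of_forall_mem fun x hx => ?_)
    simp only
    rw [pd_comm isOpen_exterior hu i j hx]
  have hI : Monotone ![i, j] := by
    rw [Fin.monotone_iff_le_succ]
    intro a
    fin_cases a
    simpa using hij
  have := eLpNorm_pdList_le_weightedNorm (k := 2) le_rfl hI p s u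
  simpa [pdList] using this

/-- A function of `W^{2,p}_{-τ}`, `p > n`, satisfies `DecayBound`. -/
theorem exists_decayBound_of_weightedNorm_le (hn : 1 ≤ n) {p τ : ℝ} (hp : (n : ℝ) < p)
    (hτ : ((n : ℝ) - 2) / 2 < τ) :
    ∃ C : ℝ, 0 < C ∧ ∀ (u : Euc n → ℝ) (A : ℝ), 0 ≤ A → ContDiffOn ℝ ∞ u (exterior n) →
      weightedNorm 2 (ENNReal.ofReal p) (-τ) u ≤ ENNReal.ofReal A → DecayBound τ (C * A) u := by
  have hn' : (1 : ℝ) ≤ n := by exact_mod_cast hn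
  obtain ⟨C₀, hC₀, h0⟩ := exists_enorm_le_of_weighted_sobolev hn hp (-τ)
  obtain ⟨C₁, hC₁, h1⟩ := exists_enorm_le_of_weighted_sobolev hn hp (-τ - 1)
  -- Second derivatives have weight exponent `q = 2 + τ`, and this `κ` gives `q - n - κ = 1 - n/2`.
  -- Its positivity is the hypothesis `τ > (n-2)/2`.
  obtain ⟨C₂, hC₂, h2⟩ := exists_lintegral_rpow_mul_le (n := n) (p := p) (by linarith)
    (κ := τ + 1 - n / 2) (by linarith)
  refine ⟨C₀.toReal + C₁.toReal + C₂.toReal + 1, by positivity, fun u A hA hu hN => ?_⟩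
  have hreal : ∀ {C : ℝ≥0∞} {a b : ℝ}, C ≠ ⊤ → 0 ≤ b →
      ‖a‖ₑ ≤ C * ENNReal.ofReal b * ENNReal.ofReal A → |a| ≤ C.toReal * A * b := by
    intro C a b hC hb h
    have := ENNReal.toReal_mono (by finiteness) h
    rw [ENNReal.toReal_mul, ENNReal.toReal_mul, ENNReal.toReal_ofReal hb,
      ENNReal.toReal_ofReal hA, toReal_enorm, Real.norm_eq_abs] at this
    linarith
  have hw0 : eLpNorm (fun y => u y * ‖y‖ ^ (- -τ)) (ENNReal.ofReal p) (scaleMeasure n) ≤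
      ENNReal.ofReal A := by
    have := (eLpNorm_pdList_le_weightedNorm (k := 2) (m := 0) (by norm_num)
      (I := Fin.elim0) (fun a => a.elim0) _ _ u).trans hN
    simpa [pdList] using this
  have hw1 : ∀ i, eLpNorm (fun y => pd i u y * ‖y‖ ^ (1 - -τ)) (ENNReal.ofReal p)
      (scaleMeasure n) ≤ ENNReal.ofReal A := by
    intro i
    have := (eLpNorm_pdList_le_weightedNorm (k := 2) (m := 1) (by norm_num)
      (I := ![i]) (fun a b _ => by simp [Subsingleton.elim a b]) _ _ u).trans hN
    simpa [pdList] using this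
  have hw2 : ∀ i j, eLpNorm (fun y => pd i (pd j u) y * ‖y‖ ^ (2 - -τ)) (ENNReal.ofReal p)
      (scaleMeasure n) ≤ ENNReal.ofReal A := fun i j =>
    (eLpNorm_pd_pd_le_weightedNorm hu _ _ i j).trans hN
  have hle : ∀ {C : ℝ≥0∞} {b : ℝ}, C.toReal ≤ C₀.toReal + C₁.toReal + C₂.toReal + 1 → 0 ≤ b →
      C.toReal * A * b ≤ (C₀.toReal + C₁.toReal + C₂.toReal + 1) * A * b := by
    intro C b h hb
    gcongr
  have p0 : 0 ≤ C₀.toReal := ENNReal.toReal_nonneg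
  have p1 : 0 ≤ C₁.toReal := ENNReal.toReal_nonneg
  have p2 : 0 ≤ C₂.toReal := ENNReal.toReal_nonneg
  refine ⟨hu, fun x hx => ?_, fun i x hx => ?_, fun i j => ?_⟩
  · have hb : 0 ≤ ‖x‖ ^ (-τ) := by positivity
    exact (hreal hC₀ hb (h0 u _ (hu.of_le (by norm_cast)) hw0 hw1 x hx)).trans
      (hle (by linarith) hb)
  · have hb : 0 ≤ ‖x‖ ^ (-τ - 1) := by positivity
    -- The embedding is applied to `∂_i u` with weight `-τ - 1`; this uses the second derivatives.
    refine (hreal hC₁ hb (h1 (pd i u) _ ((contDiffOn_pd isOpen_exterior hu i).of_le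
      (by norm_cast)) ?_ (fun j => ?_) x hx)).trans (hle (by linarith) hb)
    · convert! hw1 i using 5; ring
    · convert! hw2 j i using 5; ring
  · have := h2 (pd i (pd j u)) (2 - -τ) (measurable_pd _ _)
    have e : (2 - -τ - n - (τ + 1 - n / 2) : ℝ) = 1 - n / 2 := by ring
    rw [e] at this
    refine this.trans ((mul_le_mul_right (hw2 i j) _).trans ?_)
    rw [ENNReal.ofReal_mul (by positivity)]
    gcongr
    rw [ENNReal.le_ofReal_iff_toReal_le hC₂ (by positivity)]
    linarith

end Decay

/-! ### Polar coordinates and integrals over spheres. -/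

section Divergence

open Metric

variable {n : ℕ}

/-- The flux `∫_{S_ρ} V · ν dσ` of a vector field through a coordinate sphere. -/
def flux (V : Fin n → Euc n → ℝ) (ρ : ℝ) : ℝ :=
  sphereIntegral ρ fun x ν => ∑ i, V i x * ν i

/-- The Euclidean divergence of a vector field. -/
def divergence (V : Fin n → Euc n → ℝ) (x : Euc n) : ℝ := ∑ i, pd i (V i) x

/-- Integration in polar coordinates. -/
theorem integral_eq_integral_Ioi_integral_sphere (hn : 1 ≤ n) {h : Euc n → ℝ}
    (hh : Integrable h) :
    ∫ x, h x = ∫ t in Ioi (0 : ℝ), t ^ (n - 1) *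
      ∫ ν : sphere (0 : Euc n) 1, h (t • (ν : Euc n)) ∂(volume : Measure (Euc n)).toSphere := by
  have : Nonempty (Fin n) := ⟨⟨0, hn⟩⟩
  have hdim : Module.finrank ℝ (Euc n) = n := finrank_euclideanSpace_fin
  have mp := (volume : Measure (Euc n)).measurePreserving_homeomorphUnitSphereProd
  rw [hdim] at mp
  have hemb := (homeomorphUnitSphereProd (Euc n)).measurableEmbedding
  have hval : ∀ x : ({0}ᶜ : Set (Euc n)),
      (((homeomorphUnitSphereProd (Euc n) x).2 : ℝ) •
        ((homeomorphUnitSphereProd (Euc n) x).1 : Euc n)) = x := by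
    intro x
    have hx : ‖(x : Euc n)‖ ≠ 0 := norm_ne_zero_iff.2 x.2
    simp [smul_smul, mul_inv_cancel₀ hx]
  set k : sphere (0 : Euc n) 1 × Ioi (0 : ℝ) → ℝ := fun q => h ((q.2 : ℝ) • (q.1 : Euc n)) with hk
  have hcomp : k ∘ homeomorphUnitSphereProd (Euc n) = fun x : ({0}ᶜ : Set (Euc n)) => h x := by
    funext x
    simp only [hk, Function.comp_apply, hval]
  have hint : Integrable k ((volume : Measure (Euc n)).toSphere.prod
      (Measure.volumeIoiPow (n - 1))) := by
    rw [← mp.integrable_comp_emb hemb, hcomp]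
    have := (integrableOn_iff_comap_subtypeVal (μ := volume) (f := h)
      (measurableSet_singleton (0 : Euc n)).compl).1 hh.integrableOn
    exact this
  calc ∫ x, h x = ∫ x : ({0}ᶜ : Set (Euc n)), h x ∂(volume.comap Subtype.val) := by
        rw [integral_subtype_comap (measurableSet_singleton _).compl, restrict_compl_singleton]
    _ = ∫ q, k q ∂((volume : Measure (Euc n)).toSphere.prod (Measure.volumeIoiPow (n - 1))) := by
        rw [← mp.integral_comp hemb]
        exact integral_congr_ae (ae_of_all _ fun x => (congrFun hcomp x).symm)
    _ = ∫ t, ∫ ν, k (ν, t) ∂(volume : Measure (Euc n)).toSphere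
          ∂(Measure.volumeIoiPow (n - 1)) := integral_prod_symm _ hint
    _ = _ := by
        simp only [Measure.volumeIoiPow, ENNReal.ofReal]
        rw [integral_withDensity_eq_integral_smul, integral_subtype_comap measurableSet_Ioi
          fun t : ℝ => Real.toNNReal (t ^ (n - 1)) •
            ∫ ν : sphere (0 : Euc n) 1, h (t • (ν : Euc n)) ∂(volume : Measure (Euc n)).toSphere]
        · refine setIntegral_congr_fun measurableSet_Ioi fun t ht => ?_
          have ht0 : (0 : ℝ) < t := ht
          simp only [NNReal.smul_def, smul_eq_mul]
          rw [Real.coe_toNNReal _ (by positivity)]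
        · exact (measurable_subtype_coe.pow_const _).real_toNNReal

theorem smul_sphere_mem_exterior {t : ℝ} (ht : 1 < t) (ν : sphere (0 : Euc n) 1) :
    t • (ν : Euc n) ∈ exterior n := by
  change 1 < ‖t • (ν : Euc n)‖
  rw [norm_smul, norm_eq_of_mem_sphere, Real.norm_of_nonneg (by linarith), mul_one]
  exact ht

theorem continuousOn_integral_sphere {F : Euc n → Euc n → ℝ}
    (hF : ContinuousOn (Function.uncurry F) (exterior n ×ˢ univ)) :
    ContinuousOn (fun t : ℝ => ∫ ν : sphere (0 : Euc n) 1, F (t • (ν : Euc n)) ν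
      ∂(volume : Measure (Euc n)).toSphere) (Ioi 1) := by
  rw [continuousOn_iff_continuous_domRestrict]
  have : LocallyCompactSpace (Ioi (1 : ℝ)) := isOpen_Ioi.locallyCompactSpace
  have hc : Continuous (Function.uncurry fun (t : Ioi (1 : ℝ)) (ν : sphere (0 : Euc n) 1) =>
      F ((t : ℝ) • (ν : Euc n)) ν) :=
    hF.comp_continuous (f := fun q : Ioi (1 : ℝ) × sphere (0 : Euc n) 1 =>
      (((q.1 : ℝ) • (q.2 : Euc n), (q.2 : Euc n)) : Euc n × Euc n)) (by fun_prop)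
      fun q => ⟨smul_sphere_mem_exterior q.1.2 q.2, mem_univ _⟩
  have := continuous_parametric_integral_of_continuous
    (μ := (volume : Measure (Euc n)).toSphere) hc isCompact_univ
  rw [Measure.restrict_univ] at this
  exact this

/-- Differentiation under the integral sign; a constant dominates the derivative, since it is
continuous on a compact interval of radii times the sphere. -/
theorem hasDerivAt_integral_sphere {F : Euc n → Euc n → ℝ} {F' : Euc n → Euc n → ℝ}
    (hF : ContinuousOn (Function.uncurry F) (exterior n ×ˢ univ))
    (hF' : ContinuousOn (Function.uncurry F') (exterior n ×ˢ univ))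
    (hd : ∀ (ν : sphere (0 : Euc n) 1) (t : ℝ), 1 < t →
      HasDerivAt (fun t : ℝ => F (t • (ν : Euc n)) ν) (F' (t • (ν : Euc n)) ν) t)
    {t : ℝ} (ht : 1 < t) :
    HasDerivAt (fun t : ℝ => ∫ ν : sphere (0 : Euc n) 1, F (t • (ν : Euc n)) ν
        ∂(volume : Measure (Euc n)).toSphere)
      (∫ ν : sphere (0 : Euc n) 1, F' (t • (ν : Euc n)) ν
        ∂(volume : Measure (Euc n)).toSphere) t := by
  have hcont : ∀ {G : Euc n → Euc n → ℝ},
      ContinuousOn (Function.uncurry G) (exterior n ×ˢ univ) →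
      ContinuousOn (fun q : ℝ × sphere (0 : Euc n) 1 => G (q.1 • (q.2 : Euc n)) q.2)
        (Ioi 1 ×ˢ univ) := fun {G} hG =>
    hG.comp (f := fun q : ℝ × sphere (0 : Euc n) 1 =>
      ((q.1 • (q.2 : Euc n), (q.2 : Euc n)) : Euc n × Euc n)) (by fun_prop)
      fun q hq => ⟨smul_sphere_mem_exterior hq.1 q.2, mem_univ _⟩
  have hsec : ∀ {G : Euc n → Euc n → ℝ},
      ContinuousOn (Function.uncurry G) (exterior n ×ˢ univ) → ∀ s : ℝ, 1 < s →
      Continuous (fun ν : sphere (0 : Euc n) 1 => G (s • (ν : Euc n)) ν) := fun {G} hG s hs =>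
    hG.comp_continuous (f := fun ν : sphere (0 : Euc n) 1 =>
      ((s • (ν : Euc n), (ν : Euc n)) : Euc n × Euc n)) (by fun_prop)
      fun q => ⟨smul_sphere_mem_exterior hs q, mem_univ _⟩
  obtain ⟨a, ha1, hat⟩ := exists_between ht
  have hcpt : IsCompact (Icc a (t + 1) ×ˢ (univ : Set (sphere (0 : Euc n) 1))) :=
    isCompact_Icc.prod isCompact_univ
  obtain ⟨B, hB⟩ := hcpt.exists_bound_of_continuousOn ((hcont hF').mono
    (prod_mono_left fun s hs => lt_of_lt_of_le ha1 hs.1))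
  refine (hasDerivAt_integral_of_dominated_loc_of_deriv_le (bound := fun _ => B)
    (F := fun (t : ℝ) (ν : sphere (0 : Euc n) 1) => F (t • (ν : Euc n)) ν)
    (F' := fun (t : ℝ) (ν : sphere (0 : Euc n) 1) => F' (t • (ν : Euc n)) ν)
    (Icc_mem_nhds hat (lt_add_one t)) ?_ ?_ ?_ ?_ (integrable_const _) ?_).2
  · filter_upwards [lt_mem_nhds ht] with s hs
    exact (hsec hF s hs).aestronglyMeasurable
  · exact (hsec hF t ht).integrable_of_hasCompactSupport
      (HasCompactSupport.of_compactSpace _)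
  · exact (hsec hF' t ht).aestronglyMeasurable
  · exact ae_of_all _ fun ν s hs => hB (s, ν) ⟨hs, mem_univ _⟩
  · exact ae_of_all _ fun ν s hs => hd ν s (lt_of_lt_of_le ha1 hs.1)

end Divergence

/-! ### The divergence theorem on annuli. -/

section DivergenceTheorem

open Metric

variable {n : ℕ}

theorem continuousOn_uncurry_sum_mul {V : Fin n → Euc n → ℝ}
    (hV : ∀ i, ContinuousOn (V i) (exterior n)) :
    ContinuousOn (Function.uncurry fun x ν : Euc n => ∑ i, V i x * ν i)
      (exterior n ×ˢ univ) := by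
  refine continuousOn_finsetSum _ fun i _ => ContinuousOn.mul ?_ ?_
  · exact (hV i).comp continuousOn_fst fun q hq => hq.1
  · exact Continuous.continuousOn (by fun_prop)

theorem sum_smul_single (z : Euc n) :
    ∑ j, z j • (EuclideanSpace.single j (1 : ℝ) : Euc n) = z := by
  ext i
  simp [Finset.sum_apply, Pi.single_apply]

theorem fderiv_apply_eq_sum (u : Euc n → ℝ) (x z : Euc n) :
    fderiv ℝ u x z = ∑ j, pd j u x * z j := by
  conv_lhs => rw [← sum_smul_single z, map_sum]
  simp [pd, mul_comm]

/-- Only the existence and continuity of the derivative are needed. Its identification with the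
integral of the divergence over the sphere comes later, by duality with radial cutoffs. -/
theorem exists_hasDerivAt_flux {V : Fin n → Euc n → ℝ}
    (hV : ∀ i, ContDiffOn ℝ ∞ (V i) (exterior n)) :
    ∃ Φ' : ℝ → ℝ, ContinuousOn Φ' (Ioi 1) ∧ ∀ t, 1 < t → HasDerivAt (flux V) (Φ' t) t := by
  have hc := continuousOn_uncurry_sum_mul fun i => (hV i).continuousOn
  have hc' : ContinuousOn (Function.uncurry fun x ν : Euc n => ∑ i, (∑ j, pd j (V i) x * ν j) * ν i)
      (exterior n ×ˢ univ) := by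
    refine continuousOn_finsetSum _ fun i _ => ContinuousOn.mul
      (continuousOn_uncurry_sum_mul fun j => (contDiffOn_pd isOpen_exterior (hV i) j).continuousOn)
      (Continuous.continuousOn (by fun_prop))
  have hd : ∀ (ν : sphere (0 : Euc n) 1) (t : ℝ), 1 < t →
      HasDerivAt (fun t : ℝ => ∑ i, V i (t • (ν : Euc n)) * (ν : Euc n) i)
        (∑ i, (∑ j, pd j (V i) (t • (ν : Euc n)) * (ν : Euc n) j) * (ν : Euc n) i) t := by
    intro ν t ht
    refine HasDerivAt.fun_sum fun i _ => HasDerivAt.mul_const ?_ _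
    rw [← fderiv_apply_eq_sum]
    have h1 : HasDerivAt (fun t : ℝ => t • (ν : Euc n)) (ν : Euc n) t := by
      simpa using (hasDerivAt_id t).smul_const (ν : Euc n)
    exact (differentiableAt_of_contDiffOn isOpen_exterior (hV i)
      (smul_sphere_mem_exterior ht ν)).hasFDerivAt.comp_hasDerivAt t h1
  refine ⟨_, ?_, fun t ht => (hasDerivAt_pow (n - 1) t).mul
    (hasDerivAt_integral_sphere hc hc' hd ht)⟩
  exact ContinuousOn.add
    (ContinuousOn.mul (Continuous.continuousOn (by fun_prop)) (continuousOn_integral_sphere hc))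
    (ContinuousOn.mul (Continuous.continuousOn (by fun_prop)) (continuousOn_integral_sphere hc'))

section Cutoff

variable {χ : ℝ → ℝ} (hχ : ContDiff ℝ ∞ χ) (hχc : HasCompactSupport χ) (hχs : tsupport χ ⊆ Ioi 1)

include hχs in
theorem tsupport_comp_norm_subset {ψ : ℝ → ℝ} (hψ : tsupport ψ ⊆ tsupport χ) :
    tsupport (fun x : Euc n => ψ ‖x‖) ⊆ exterior n := fun _ hx =>
  hχs (hψ (tsupport_comp_subset_preimage ψ continuous_norm hx))

theorem hasCompactSupport_comp_norm {ψ : ℝ → ℝ} (hψ : HasCompactSupport ψ) :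
    HasCompactSupport (fun x : Euc n => ψ ‖x‖) := by
  obtain ⟨R, hR⟩ := hψ.isCompact.isBounded.subset_closedBall (0 : ℝ)
  refine HasCompactSupport.of_support_subset_isCompact (isCompact_closedBall (0 : Euc n) R)
    fun x hx => ?_
  have := hR (subset_tsupport ψ hx)
  simpa using this

theorem integrable_mul_of_tsupport_subset {f g : Euc n → ℝ} (hf : Continuous f)
    (hfc : HasCompactSupport f) (hfs : tsupport f ⊆ exterior n)
    (hg : ContinuousOn g (exterior n)) : Integrable (fun x => f x * g x) := by
  have hsub : tsupport (fun x => f x * g x) ⊆ tsupport f := closure_mono fun _ hx => by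
    intro h0
    exact hx (by simp [h0])
  refine Continuous.integrable_of_hasCompactSupport ?_ hfc.mul_right
  exact (hf.continuousOn.mul hg).continuous_of_tsupport_subset isOpen_exterior (hsub.trans hfs)

-- The norm is not differentiable at the origin, but the cutoff vanishes near it.
include hχ hχs in
theorem differentiable_comp_norm : Differentiable ℝ (fun x : Euc n => χ ‖x‖) := by
  intro x
  by_cases hx : x = 0
  · have : (fun x : Euc n => χ ‖x‖) =ᶠ[𝓝 x] fun _ => 0 := by
      refine notMem_tsupport_iff_eventuallyEq.1 fun h => ?_
      have := tsupport_comp_norm_subset hχs subset_rfl h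
      rw [hx] at this
      simp [exterior] at this
      linarith
    exact this.differentiableAt_iff.2 (differentiableAt_const _)
  · exact ((hχ.differentiable (by simp)).differentiableAt).comp x
      ((contDiffAt_norm ℝ hx (n := 1)).differentiableAt one_ne_zero)

theorem pd_comp_norm (hχ : ContDiff ℝ ∞ χ) {x : Euc n} (hx : x ≠ 0) (i : Fin n) :
    pd i (fun x : Euc n => χ ‖x‖) x = deriv χ ‖x‖ * (‖x‖⁻¹ * x i) := by
  have h1 : HasFDerivAt (fun x : Euc n => ‖x‖) (‖x‖⁻¹ • innerSL ℝ x) x := by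
    have h2 := (hasStrictFDerivAt_norm_sq x).hasFDerivAt.sqrt (by positivity)
    have e : (fun x : Euc n => √(‖x‖ ^ 2)) = fun x => ‖x‖ := by
      funext y; rw [Real.sqrt_sq (norm_nonneg y)]
    rw [e, Real.sqrt_sq (norm_nonneg x)] at h2
    convert! h2 using 1
    rw [← Nat.cast_smul_eq_nsmul ℝ, smul_smul]
    congr 1
    field_simp
    norm_num
  have h3 := ((hχ.differentiable (by simp)).differentiableAt (x := ‖x‖)).hasDerivAt.comp_hasFDerivAt
    x h1
  have h4 : fderiv ℝ (fun x : Euc n => χ ‖x‖) x = _ := h3.fderiv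
  rw [pd, h4]
  simp [EuclideanSpace.inner_single_right]

-- Integration by parts on all of `ℝⁿ`. The cutoff is supported in the exterior region, so the
-- arbitrary values of `v` elsewhere do not contribute.
include hχ hχc hχs in
theorem integral_cutoff_mul_pd {v : Euc n → ℝ} (hv : ContDiffOn ℝ ∞ v (exterior n)) (i : Fin n) :
    Integrable (fun x => χ ‖x‖ * pd i v x) ∧
    Integrable (fun x => (deriv χ ‖x‖ * (‖x‖⁻¹ * x i)) * v x) ∧
    ∫ x, χ ‖x‖ * pd i v x = - ∫ x, (deriv χ ‖x‖ * (‖x‖⁻¹ * x i)) * v x := by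
  have hd := differentiable_comp_norm (n := n) hχ hχs
  have hfs := tsupport_comp_norm_subset (n := n) hχs subset_rfl
  have hcs := hasCompactSupport_comp_norm (n := n) hχc
  have hts : tsupport (deriv χ) ⊆ tsupport χ := tsupport_deriv_subset
  -- At the origin both sides vanish: the cutoff is zero nearby and the coordinate `x i` is zero.
  have e : ∀ x, pd i (fun x : Euc n => χ ‖x‖) x = deriv χ ‖x‖ * (‖x‖⁻¹ * x i) := by
    intro x
    by_cases hx : x = 0
    · have : (fun x : Euc n => χ ‖x‖) =ᶠ[𝓝 x] fun _ => 0 := by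
        refine notMem_tsupport_iff_eventuallyEq.1 fun h => ?_
        have := hfs h
        rw [hx] at this
        simp [exterior] at this
        linarith
      rw [pd_congr_of_eventuallyEq this]
      simp [pd, hx]
    · exact pd_comp_norm hχ hx i
  have hw : Integrable (fun x : Euc n => (deriv χ ‖x‖) * ((‖x‖⁻¹ * x i) * v x)) := by
    refine integrable_mul_of_tsupport_subset ((hχ.continuous_deriv (by simp)).comp continuous_norm)
      (hasCompactSupport_comp_norm hχc.deriv)
      (tsupport_comp_norm_subset hχs hts) ?_
    refine ContinuousOn.mul (ContinuousOn.mul ?_ ?_) hv.continuousOn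
    · refine continuous_norm.continuousOn.inv₀ fun x hx => ?_
      have : 1 < ‖x‖ := hx
      positivity
    · exact Continuous.continuousOn (by fun_prop)
  have hw' : Integrable (fun x : Euc n => (deriv χ ‖x‖ * (‖x‖⁻¹ * x i)) * v x) := by
    simpa only [mul_assoc] using hw
  have hint := integrable_mul_of_tsupport_subset hd.continuous hcs hfs
    (contDiffOn_pd isOpen_exterior hv i).continuousOn
  refine ⟨hint, hw', ?_⟩
  have := integral_mul_fderiv_eq_neg_fderiv_mul_of_integrable (μ := (volume : Measure (Euc n)))
    (f := fun x : Euc n => χ ‖x‖) (g := v) (v := EuclideanSpace.single i (1 : ℝ))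
    (hw'.congr (ae_of_all _ fun x => by simp only [← e]; rfl)) hint
    (integrable_mul_of_tsupport_subset hd.continuous hcs hfs hv.continuousOn)
    (fun x _ => hd x)
    (fun x hx => differentiableAt_of_contDiffOn isOpen_exterior hv (hfs hx))
  rw [show (∫ x, χ ‖x‖ * pd i v x) = ∫ x, χ ‖x‖ * fderiv ℝ v x (EuclideanSpace.single i 1) from rfl,
    this]
  congr 1
  refine integral_congr_ae (ae_of_all _ fun x => ?_)
  simp only
  rw [← e]
  rfl

theorem integral_Ioi_eq_integral_of_tsupport {f g : ℝ → ℝ} (hfs : tsupport f ⊆ Ioi 1) :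
    ∫ t in Ioi (0 : ℝ), f t * g t = ∫ t, f t * g t := by
  refine setIntegral_eq_integral_of_forall_compl_eq_zero fun t ht => ?_
  have : t ∉ tsupport f := fun h => ht (lt_trans one_pos (show 1 < t from hfs h))
  rw [image_eq_zero_of_notMem_tsupport this, zero_mul]

-- The weak form of "the derivative of the flux is the integral of the divergence over the sphere":
-- integrate by parts against `χ(|x|)`, whose gradient is `χ'(|x|)` times the radial normal, then
-- use polar coordinates.
include hχ hχc hχs in
theorem integral_cutoff_mul_divergence (hn : 1 ≤ n) {V : Fin n → Euc n → ℝ}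
    (hV : ∀ i, ContDiffOn ℝ ∞ (V i) (exterior n)) :
    ∫ t, χ t * (t ^ (n - 1) * ∫ ν : sphere (0 : Euc n) 1, divergence V (t • (ν : Euc n))
        ∂(volume : Measure (Euc n)).toSphere) = - ∫ t, deriv χ t * flux V t := by
  have h := fun i => integral_cutoff_mul_pd hχ hχc hχs (hV i) i
  have e1 : ∫ x, χ ‖x‖ * divergence V x =
      - ∫ x, deriv χ ‖x‖ * ∑ i, V i x * (‖x‖⁻¹ * x i) := by
    simp only [divergence, Finset.mul_sum]
    rw [integral_finsetSum _ fun i _ => (h i).1, integral_finsetSum, ← Finset.sum_neg_distrib]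
    · refine Finset.sum_congr rfl fun i _ => ?_
      rw [(h i).2.2]
      congr 1
      refine integral_congr_ae (ae_of_all _ fun x => ?_)
      simp only
      ring
    · intro i _
      refine (h i).2.1.congr (ae_of_all _ fun x => ?_)
      simp only
      ring
  have i1 : Integrable (fun x => χ ‖x‖ * divergence V x) := by
    simp only [divergence, Finset.mul_sum]
    exact integrable_finsetSum _ fun i _ => (h i).1
  have i2 : Integrable (fun x => deriv χ ‖x‖ * ∑ i, V i x * (‖x‖⁻¹ * x i)) := by
    simp only [Finset.mul_sum]
    refine integrable_finsetSum _ fun i _ => (h i).2.1.congr (ae_of_all _ fun x => ?_)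
    simp only
    ring
  rw [integral_eq_integral_Ioi_integral_sphere hn i1,
    integral_eq_integral_Ioi_integral_sphere hn i2] at e1
  have hts : tsupport (deriv χ) ⊆ Ioi 1 := tsupport_deriv_subset.trans hχs
  rw [← integral_Ioi_eq_integral_of_tsupport hχs, ← integral_Ioi_eq_integral_of_tsupport hts]
  have hnorm : ∀ t ∈ Ioi (0 : ℝ), ∀ ν : sphere (0 : Euc n) 1, ‖t • (ν : Euc n)‖ = t := by
    intro t ht ν
    rw [norm_smul, norm_eq_of_mem_sphere, Real.norm_of_nonneg (le_of_lt ht), mul_one]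
  refine Eq.trans ?_ (e1.trans ?_)
  · refine setIntegral_congr_fun measurableSet_Ioi fun t ht => ?_
    simp only [hnorm t ht]
    rw [integral_const_mul]
    ring
  · congr 1
    refine setIntegral_congr_fun measurableSet_Ioi fun t ht => ?_
    have ht0 : t ≠ 0 := ne_of_gt ht
    simp only [hnorm t ht, flux, sphereIntegral]
    rw [integral_const_mul]
    simp only [PiLp.smul_apply, smul_eq_mul, inv_mul_cancel_left₀ ht0]
    ring

end Cutoff

/-- The divergence theorem on a spherical annulus. -/
theorem flux_sub_flux (hn : 1 ≤ n) {V : Fin n → Euc n → ℝ}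
    (hV : ∀ i, ContDiffOn ℝ ∞ (V i) (exterior n)) {r ρ : ℝ} (hr : 1 < r) (hρ : r ≤ ρ) :
    flux V ρ - flux V r = ∫ x in {x : Euc n | r < ‖x‖ ∧ ‖x‖ ≤ ρ}, divergence V x := by
  obtain ⟨Φ', hΦc, hΦ⟩ := exists_hasDerivAt_flux hV
  have hdiv : ContinuousOn (divergence V) (exterior n) :=
    continuousOn_finsetSum _ fun i _ => (contDiffOn_pd isOpen_exterior (hV i) i).continuousOn
  set D : ℝ → ℝ := fun t => t ^ (n - 1) * ∫ ν : sphere (0 : Euc n) 1,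
    divergence V (t • (ν : Euc n)) ∂(volume : Measure (Euc n)).toSphere with hD
  have hDc : ContinuousOn D (Ioi 1) := by
    refine ContinuousOn.mul (Continuous.continuousOn (by fun_prop))
      (continuousOn_integral_sphere (F := fun x _ => divergence V x) ?_)
    exact hdiv.comp continuousOn_fst fun q hq => hq.1
  have hflux : ContinuousOn (flux V) (Ioi 1) := fun t ht =>
    (hΦ t ht).continuousAt.continuousWithinAt
  have hint : ∀ {f g : ℝ → ℝ}, Continuous f → HasCompactSupport f → tsupport f ⊆ Ioi 1 →
      ContinuousOn g (Ioi 1) → Integrable (fun t => f t * g t) := by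
    intro f g hf hfc hfs hg
    have hsub : tsupport (fun x => f x * g x) ⊆ tsupport f := closure_mono fun _ hx => by
      intro h0
      exact hx (by simp [h0])
    exact Continuous.integrable_of_hasCompactSupport
      ((hf.continuousOn.mul hg).continuous_of_tsupport_subset isOpen_Ioi (hsub.trans hfs))
      hfc.mul_right
  -- For every test function, `∫ χ D = -∫ χ' flux = ∫ χ Φ'`; the fundamental lemma of the calculus
  -- of variations gives equality almost everywhere, which suffices after integration in `t`.
  have hae : ∀ᵐ t : ℝ, t ∈ Ioi (1 : ℝ) → D t - Φ' t = 0 := by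
    refine isOpen_Ioi.ae_eq_zero_of_integral_contDiff_smul_eq_zero
      ((hDc.sub hΦc).locallyIntegrableOn measurableSet_Ioi) fun χ hχ hχc hχs => ?_
    have hχ' : Continuous (deriv χ) := hχ.continuous_deriv (by simp)
    have hts : tsupport (deriv χ) ⊆ Ioi 1 := tsupport_deriv_subset.trans hχs
    have h1 := integral_cutoff_mul_divergence hχ hχc hχs hn hV
    have hfd : ∀ t ∈ tsupport χ, fderiv ℝ (flux V) t 1 = Φ' t := fun t ht => by
      rw [(hΦ t (hχs ht)).hasFDerivAt.fderiv]; simp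
    have hfd' : ∀ t, χ t * fderiv ℝ (flux V) t 1 = χ t * Φ' t := fun t => by
      by_cases ht : t ∈ tsupport χ
      · rw [hfd t ht]
      · rw [image_eq_zero_of_notMem_tsupport ht, zero_mul, zero_mul]
    have h2 := integral_mul_fderiv_eq_neg_fderiv_mul_of_integrable (μ := (volume : Measure ℝ))
      (f := χ) (g := flux V) (v := (1 : ℝ))
      (by simpa using hint hχ' hχc.deriv hts hflux)
      (by simpa only [hfd'] using hint hχ.continuous hχc hχs hΦc)
      (hint hχ.continuous hχc hχs hflux)
      (fun t _ => (hχ.differentiable (by simp)).differentiableAt)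
      (fun t ht => (hΦ t (hχs ht)).differentiableAt)
    simp only [hfd'] at h2
    simp only [fderiv_eq_smul_deriv, smul_eq_mul, one_mul] at h2
    simp only [smul_eq_mul, mul_sub]
    rw [integral_sub (hint hχ.continuous hχc hχs hDc) (hint hχ.continuous hχc hχs hΦc), h2, h1]
    ring
  have hsub : Icc r ρ ⊆ Ioi 1 := fun t ht => lt_of_lt_of_le hr ht.1
  have ftc : ∫ t in r..ρ, Φ' t = flux V ρ - flux V r := by
    refine intervalIntegral.integral_eq_sub_of_hasDerivAt (fun t ht => ?_)
      ((hΦc.mono hsub).intervalIntegrable_of_Icc hρ)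
    rw [uIcc_of_le hρ] at ht
    exact hΦ t (hsub ht)
  set A : Set (Euc n) := {x : Euc n | r < ‖x‖ ∧ ‖x‖ ≤ ρ} with hA
  have hAm : MeasurableSet A :=
    (measurableSet_lt measurable_const measurable_norm).inter
      (measurableSet_le measurable_norm measurable_const)
  have hAint : IntegrableOn (divergence V) A := by
    have hK : IsCompact {x : Euc n | r ≤ ‖x‖ ∧ ‖x‖ ≤ ρ} := by
      refine (isCompact_closedBall (0 : Euc n) ρ).of_isClosed_subset
        ((isClosed_le continuous_const continuous_norm).inter
          (isClosed_le continuous_norm continuous_const)) fun x hx => by simpa using hx.2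
    exact ((hdiv.mono fun x hx => lt_of_lt_of_le hr hx.1).integrableOn_compact hK).mono_set
      fun x hx => ⟨hx.1.le, hx.2⟩
  rw [← ftc, ← integral_indicator hAm, integral_eq_integral_Ioi_integral_sphere hn
    ((integrable_indicator_iff hAm).2 hAint), intervalIntegral.integral_of_le hρ,
    ← integral_indicator measurableSet_Ioc, ← integral_indicator measurableSet_Ioi]
  refine integral_congr_ae ?_
  filter_upwards [hae] with t ht
  by_cases ht1 : t ∈ Ioc r ρ
  · have h1 : t ∈ Ioi (1 : ℝ) := lt_trans hr ht1.1
    have h0 : t ∈ Ioi (0 : ℝ) := lt_trans one_pos (show 1 < t from h1)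
    rw [indicator_of_mem ht1, indicator_of_mem h0, ← sub_eq_zero.1 (ht h1), hD]
    simp only
    congr 2
    funext ν
    rw [indicator_of_mem]
    simpa [hA, norm_smul, abs_of_pos (show 0 < t from h0)] using ht1
  · rw [indicator_of_notMem ht1]
    by_cases h0 : t ∈ Ioi (0 : ℝ)
    · rw [indicator_of_mem h0]
      have : ∀ ν : sphere (0 : Euc n) 1, A.indicator (divergence V) (t • (ν : Euc n)) = 0 := by
        intro ν
        rw [indicator_of_notMem]
        simpa [hA, norm_smul, abs_of_pos (show 0 < t from h0)] using ht1
      simp [this]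
    · rw [indicator_of_notMem h0]

/-- If the divergence is integrable near infinity, the flux through large spheres converges. -/
theorem tendsto_flux (hn : 1 ≤ n) {V : Fin n → Euc n → ℝ}
    (hV : ∀ i, ContDiffOn ℝ ∞ (V i) (exterior n)) {r : ℝ} (hr : 1 < r)
    (hint : IntegrableOn (divergence V) {x : Euc n | r < ‖x‖}) :
    Tendsto (flux V) atTop
      (𝓝 (flux V r + ∫ x in {x : Euc n | r < ‖x‖}, divergence V x)) := by
  have hU : (⋃ ρ : ℝ, {x : Euc n | r < ‖x‖ ∧ ‖x‖ ≤ ρ}) = {x : Euc n | r < ‖x‖} := by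
    ext x
    simp only [mem_iUnion, mem_ofPred_eq]
    exact ⟨fun ⟨_, h⟩ => h.1, fun h => ⟨‖x‖, h, le_rfl⟩⟩
  have h1 := tendsto_setIntegral_of_monotone (μ := (volume : Measure (Euc n)))
    (s := fun ρ : ℝ => {x : Euc n | r < ‖x‖ ∧ ‖x‖ ≤ ρ}) (f := divergence V)
    (fun ρ => (measurableSet_lt measurable_const measurable_norm).inter
      (measurableSet_le measurable_norm measurable_const))
    (fun ρ ρ' h x hx => ⟨hx.1, hx.2.trans h⟩) (by rw [hU]; exact hint)
  rw [hU] at h1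
  refine (h1.const_add (flux V r)).congr' ?_
  filter_upwards [eventually_ge_atTop r] with ρ hρ
  rw [← flux_sub_flux hn hV hr hρ]
  ring

end DivergenceTheorem

/-! ### Partial derivatives, and inverses of matrices close to the identity. -/

section PointwiseCalculus

variable {n : ℕ}

theorem abs_sum_fin_le {f : Fin n → ℝ} {c : ℝ} (h : ∀ i, |f i| ≤ c) : |∑ i, f i| ≤ n * c := by
  refine (Finset.abs_sum_le_sum_abs _ _).trans ((Finset.sum_le_sum fun i _ => h i).trans ?_)
  simp

theorem abs_mul_le {a b c d : ℝ} (ha : |a| ≤ c) (hb : |b| ≤ d) : |a * b| ≤ c * d := by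
  rw [abs_mul]
  exact mul_le_mul ha hb (abs_nonneg b) ((abs_nonneg a).trans ha)

theorem pd_sub {u v : Euc n → ℝ} {x : Euc n} (hu : DifferentiableAt ℝ u x)
    (hv : DifferentiableAt ℝ v x) (i : Fin n) :
    pd i (fun y => u y - v y) x = pd i u x - pd i v x := by
  rw [pd, fderiv_fun_sub hu hv]; rfl

theorem pd_mul {u v : Euc n → ℝ} {x : Euc n} (hu : DifferentiableAt ℝ u x)
    (hv : DifferentiableAt ℝ v x) (i : Fin n) :
    pd i (fun y => u y * v y) x = pd i u x * v x + u x * pd i v x := by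
  rw [pd, fderiv_fun_mul hu hv]
  simp [pd]
  ring

theorem pd_const_mul {u : Euc n → ℝ} {x : Euc n} (hu : DifferentiableAt ℝ u x) (c : ℝ)
    (i : Fin n) : pd i (fun y => c * u y) x = c * pd i u x := by
  rw [pd, fderiv_const_mul hu]
  rfl

theorem pd_sum {ι : Type*} [Fintype ι] {u : ι → Euc n → ℝ} {x : Euc n}
    (hu : ∀ a, DifferentiableAt ℝ (u a) x) (i : Fin n) :
    pd i (fun y => ∑ a, u a y) x = ∑ a, pd i (u a) x := by
  rw [pd, fderiv_fun_sum fun a _ => hu a]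
  simp [pd]

theorem pd_exp_neg {u : Euc n → ℝ} {x : Euc n} (hu : DifferentiableAt ℝ u x) (i : Fin n) :
    pd i (fun y => Real.exp (-(u y))) x = -(pd i u x * Real.exp (-(u x))) := by
  have h : HasFDerivAt (fun y => Real.exp (-(u y))) (Real.exp (-(u x)) • -(fderiv ℝ u x)) x :=
    hu.hasFDerivAt.neg.exp
  rw [pd, h.fderiv]
  simp [pd]
  ring

/-- The inverse of a matrix close to the identity. -/
theorem inv_bounds_of_close_to_one (hn : 1 ≤ n) {A : Matrix (Fin n) (Fin n) ℝ} {η : ℝ}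
    (hη : 2 * n * η ≤ 1)
    (hA : ∀ i j, |A i j - (1 : Matrix (Fin n) (Fin n) ℝ) i j| ≤ η) :
    A.det ≠ 0 ∧ (∀ i j, |A⁻¹ i j| ≤ 2) ∧
      ∀ i j, |A⁻¹ i j - (1 : Matrix (Fin n) (Fin n) ℝ) i j| ≤ 2 * n * η := by
  have hn' : (1 : ℝ) ≤ n := by exact_mod_cast hn
  have hne : Nonempty (Fin n) := ⟨⟨0, hn⟩⟩
  have hη0 : 0 ≤ η := (abs_nonneg _).trans (hA ⟨0, hn⟩ ⟨0, hn⟩)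
  -- Strict diagonal dominance: the off-diagonal row sum is at most `(n - 1) η`, which is less than
  -- `1 - η`.
  have hdet : A.det ≠ 0 := by
    refine det_ne_zero_of_sum_row_lt_diag fun k => ?_
    have h1 : ∑ j ∈ Finset.univ.erase k, ‖A k j‖ ≤ ∑ j ∈ Finset.univ.erase k, η := by
      refine Finset.sum_le_sum fun j hj => ?_
      have := hA k j
      rwa [Matrix.one_apply_ne (Finset.ne_of_mem_erase hj).symm, sub_zero] at this
    rw [Finset.sum_const, Finset.card_erase_of_mem (Finset.mem_univ k), Finset.card_univ,
      Fintype.card_fin, nsmul_eq_mul, Nat.cast_sub hn] at h1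
    have h2 := hA k k
    rw [Matrix.one_apply_eq] at h2
    have h3 : 1 - η ≤ ‖A k k‖ := by
      rw [Real.norm_eq_abs]
      have := (abs_le.1 h2).1
      have := le_abs_self (A k k)
      linarith
    push_cast at h1
    nlinarith
  have hmul : A * A⁻¹ = 1 := A.mul_nonsing_inv (isUnit_iff_ne_zero.2 hdet)
  have hid : ∀ i j, A⁻¹ i j - (1 : Matrix (Fin n) (Fin n) ℝ) i j =
      -∑ k, (A i k - (1 : Matrix (Fin n) (Fin n) ℝ) i k) * A⁻¹ k j := by
    intro i j
    have h1 := congrFun (congrFun hmul i) j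
    rw [Matrix.mul_apply] at h1
    simp only [sub_mul, Finset.sum_sub_distrib, h1]
    simp [Matrix.one_apply]
  -- The largest entry `m` of a column satisfies `m ≤ 1 + n η m ≤ 1 + m / 2`, by the identity `A⁻¹ -
  -- 1 = -(A - 1) A⁻¹`.
  have hcol : ∀ j, ∀ i, |A⁻¹ i j| ≤ 2 := by
    intro j
    obtain ⟨i₀, -, hi₀⟩ := Finset.exists_max_image Finset.univ (fun i => |A⁻¹ i j|)
      Finset.univ_nonempty
    have h1 : |A⁻¹ i₀ j - (1 : Matrix (Fin n) (Fin n) ℝ) i₀ j| ≤ n * (η * |A⁻¹ i₀ j|) := by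
      rw [hid, abs_neg]
      exact abs_sum_fin_le fun k => abs_mul_le (hA i₀ k) (hi₀ k (Finset.mem_univ k))
    have h2 : |(1 : Matrix (Fin n) (Fin n) ℝ) i₀ j| ≤ 1 := by
      rw [Matrix.one_apply]; split_ifs <;> simp
    have h3 := abs_sub_abs_le_abs_sub (A⁻¹ i₀ j) ((1 : Matrix (Fin n) (Fin n) ℝ) i₀ j)
    have h4 := abs_nonneg (A⁻¹ i₀ j)
    have h5 : |A⁻¹ i₀ j| ≤ 2 := by nlinarith
    exact fun i => (hi₀ i (Finset.mem_univ i)).trans h5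
  refine ⟨hdet, fun i j => hcol j i, fun i j => ?_⟩
  rw [hid, abs_neg]
  refine (abs_sum_fin_le fun k => abs_mul_le (hA i k) (hcol j k)).trans (le_of_eq ?_)
  ring

theorem differentiableAt_det {ι : Type*} [Fintype ι] [DecidableEq ι]
    {G : Euc n → Matrix ι ι ℝ} {x : Euc n}
    (hG : ∀ i j, DifferentiableAt ℝ (fun y => G y i j) x) :
    DifferentiableAt ℝ (fun y => (G y).det) x := by
  simp only [Matrix.det_apply']
  refine DifferentiableAt.fun_sum fun σ _ => DifferentiableAt.const_mul ?_ _
  exact (HasFDerivAt.finsetProd (u := Finset.univ) (g := fun i y => G y (σ i) i)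
    fun i _ => (hG (σ i) i).hasFDerivAt).differentiableAt

theorem differentiableAt_inv_apply {G : Euc n → Matrix (Fin n) (Fin n) ℝ} {x : Euc n}
    (hG : ∀ i j, DifferentiableAt ℝ (fun y => G y i j) x) (hdet : (G x).det ≠ 0) (i j : Fin n) :
    DifferentiableAt ℝ (fun y => (G y)⁻¹ i j) x := by
  simp only [Matrix.inv_def, Ring.inverse_eq_inv', Matrix.smul_apply, smul_eq_mul,
    Matrix.adjugate_apply]
  refine ((differentiableAt_det hG).inv hdet).mul (differentiableAt_det fun a b => ?_)
  by_cases h : a = j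
  · subst h
    simp
  · simp only [Matrix.updateRow_ne h]
    exact hG a b

/-- Differentiating `G G⁻¹ = 1` gives `∂G⁻¹ = -G⁻¹ (∂G) G⁻¹`: each entry is a sum of `n²` terms,
each at most `2 · d · 2`. -/
theorem abs_pd_inv_le {G : Euc n → Matrix (Fin n) (Fin n) ℝ} {x : Euc n} {d : ℝ}
    (hG : ∀ i j, DifferentiableAt ℝ (fun y => G y i j) x) (hdet : (G x).det ≠ 0)
    (hinv : ∀ i j, |(G x)⁻¹ i j| ≤ 2) (k : Fin n)
    (hd : ∀ i j, |pd k (fun y => G y i j) x| ≤ d) (i j : Fin n) :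
    |pd k (fun y => (G y)⁻¹ i j) x| ≤ 4 * n ^ 2 * d := by
  set H := (G x)⁻¹ with hH
  set dG : Matrix (Fin n) (Fin n) ℝ := Matrix.of fun a b => pd k (fun y => G y a b) x
  set dH : Matrix (Fin n) (Fin n) ℝ := Matrix.of fun a b => pd k (fun y => (G y)⁻¹ a b) x
  have hHd := differentiableAt_inv_apply hG hdet
  have hprod : dG * H + G x * dH = 0 := by
    ext a b
    have h1 : (fun y => ∑ c, G y a c * (G y)⁻¹ c b) =ᶠ[𝓝 x]
        fun _ => (1 : Matrix (Fin n) (Fin n) ℝ) a b := by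
      filter_upwards [(differentiableAt_det hG).continuousAt.eventually_ne hdet] with y hy
      rw [← (G y).mul_nonsing_inv (isUnit_iff_ne_zero.2 hy), Matrix.mul_apply]
    have h2 := pd_congr_of_eventuallyEq h1 k
    rw [pd_sum (fun c => (hG a c).fun_mul (hHd c b))] at h2
    simp only [pd_mul (hG a _) (hHd _ b)] at h2
    rw [Finset.sum_add_distrib] at h2
    rw [Matrix.add_apply, Matrix.mul_apply, Matrix.mul_apply]
    simpa [pd, dG, dH, hH] using h2
  have hdH : dH = -(H * (dG * H)) := by
    have h1 : H * (G x * dH) = dH := by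
      rw [← Matrix.mul_assoc, (G x).nonsing_inv_mul (isUnit_iff_ne_zero.2 hdet), Matrix.one_mul]
    rw [← h1, eq_neg_of_add_eq_zero_right hprod, Matrix.mul_neg]
  have h3 : pd k (fun y => (G y)⁻¹ i j) x = -∑ a, H i a * ∑ b, dG a b * H b j := by
    have := congrFun (congrFun hdH i) j
    rw [Matrix.neg_apply, Matrix.mul_apply] at this
    simp only [Matrix.mul_apply] at this
    exact this
  rw [h3, abs_neg]
  refine (abs_sum_fin_le fun a => abs_mul_le (hinv i a)
    (abs_sum_fin_le fun b => abs_mul_le (hd a b) (hinv b j))).trans (le_of_eq ?_)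
  ring

end PointwiseCalculus

/-! ### Curvature as a divergence up to quadratic terms. -/

section CurvatureExpansion

variable {n : ℕ}

/-- The combination `∂_i g_{jk} + ∂_j g_{ik} - ∂_k g_{ij}`. -/
def koszul (G : Euc n → Matrix (Fin n) (Fin n) ℝ) (k i j : Fin n) (x : Euc n) : ℝ :=
  pd i (fun y => G y j k) x + pd j (fun y => G y i k) x - pd k (fun y => G y i j) x

/-- The vector field `∂_j g_{ij} - ∂_i g_{jj}` of the ADM mass. -/
def admField (G : Euc n → Matrix (Fin n) (Fin n) ℝ) (i : Fin n) (x : Euc n) : ℝ :=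
  ∑ j, (pd j (fun y => G y i j) x - pd i (fun y => G y j j) x)

/-- The vector field `e^{-f} ∂_i f`. -/
def weightField (f : Euc n → ℝ) (i : Fin n) (x : Euc n) : ℝ :=
  pd i f x * Real.exp (-(f x))

/-- Pointwise `C²` bounds, in coordinates, for a metric close to the Euclidean one and for a
weight. -/
structure PointBounds (G : Euc n → Matrix (Fin n) (Fin n) ℝ) (f : Euc n → ℝ) (x : Euc n)
    (η d₁ d₂ : ℝ) : Prop where
  small : 2 * n * η ≤ 1
  close : ∀ i j, |G x i j - (1 : Matrix (Fin n) (Fin n) ℝ) i j| ≤ η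
  pd_le : ∀ k i j, |pd k (fun y => G y i j) x| ≤ d₁
  pd_pd_le : ∀ k l i j, |pd k (pd l fun y => G y i j) x| ≤ d₂
  weight_le : |f x| ≤ η
  pd_weight_le : ∀ k, |pd k f x| ≤ d₁
  pd_pd_weight_le : ∀ k l, |pd k (pd l f) x| ≤ d₂

section

variable {U : Set (Euc n)} {G : Euc n → Matrix (Fin n) (Fin n) ℝ} {f : Euc n → ℝ} {x : Euc n}
  {η d₁ d₂ : ℝ}

theorem contDiffOn_koszul (hU : IsOpen U) (hG : ∀ i j, ContDiffOn ℝ ∞ (fun y => G y i j) U)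
    (k i j : Fin n) : ContDiffOn ℝ ∞ (koszul G k i j) U :=
  ((contDiffOn_pd hU (hG j k) i).add (contDiffOn_pd hU (hG i k) j)).sub
    (contDiffOn_pd hU (hG i j) k)

theorem contDiffOn_admField (hU : IsOpen U) (hG : ∀ i j, ContDiffOn ℝ ∞ (fun y => G y i j) U)
    (i : Fin n) : ContDiffOn ℝ ∞ (admField G i) U :=
  ContDiffOn.sum fun j _ => (contDiffOn_pd hU (hG i j) j).sub (contDiffOn_pd hU (hG j j) i)

theorem contDiffOn_weightField (hU : IsOpen U) (hf : ContDiffOn ℝ ∞ f U) (i : Fin n) :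
    ContDiffOn ℝ ∞ (weightField f i) U :=
  (contDiffOn_pd hU hf i).mul hf.neg.exp

theorem pd_koszul (hU : IsOpen U) (hG : ∀ i j, ContDiffOn ℝ ∞ (fun y => G y i j) U) (hx : x ∈ U)
    (m k i j : Fin n) : pd m (koszul G k i j) x =
      pd m (pd i fun y => G y j k) x + pd m (pd j fun y => G y i k) x -
        pd m (pd k fun y => G y i j) x := by
  have hd : ∀ a b c, DifferentiableAt ℝ (pd a fun y => G y b c) x := fun a b c =>
    differentiableAt_of_contDiffOn hU (contDiffOn_pd hU (hG b c) a) hx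
  unfold koszul
  rw [pd_sub ((hd _ _ _).fun_add (hd _ _ _)) (hd _ _ _), pd_add (hd _ _ _) (hd _ _ _)]

theorem christoffel_eq (k i j : Fin n) :
    christoffel G k i j = fun y => 1 / 2 * ∑ l, (G y)⁻¹ k l * koszul G l i j y := rfl

/-- The linear part of the Ricci curvature at the Euclidean metric. -/
def linearRicci (G : Euc n → Matrix (Fin n) (Fin n) ℝ) (i j : Fin n) (x : Euc n) : ℝ :=
  ∑ k, (1 / 2 * pd k (koszul G k i j) x - 1 / 2 * pd j (koszul G k i k) x)

/-- The Euclidean trace of the linearized Ricci curvature is `∂_i ∂_j g_{ij} - ∂_i ∂_i g_{jj}`,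
exactly a divergence; mixed derivatives are commuted and one double sum is reindexed. -/
theorem sum_linearRicci (hU : IsOpen U) (hG : ∀ i j, ContDiffOn ℝ ∞ (fun y => G y i j) U)
    (hx : x ∈ U) : ∑ i, linearRicci G i i x = divergence (admField G) x := by
  have hd : ∀ a b c, DifferentiableAt ℝ (pd a fun y => G y b c) x := fun a b c =>
    differentiableAt_of_contDiffOn hU (contDiffOn_pd hU (hG b c) a) hx
  have h1 : ∀ i, pd i (admField G i) x = ∑ j, (pd i (pd j fun y => G y i j) x -
      pd i (pd i fun y => G y j j) x) := by
    intro i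
    unfold admField
    rw [pd_sum fun j => (hd _ _ _).fun_sub (hd _ _ _)]
    exact Finset.sum_congr rfl fun j _ => pd_sub (hd _ _ _) (hd _ _ _) i
  have h2 : ∀ i, linearRicci G i i x = ∑ k, (pd i (pd k fun y => G y i k) x -
      1 / 2 * pd k (pd k fun y => G y i i) x - 1 / 2 * pd i (pd i fun y => G y k k) x) := by
    intro i
    refine Finset.sum_congr rfl fun k _ => ?_
    rw [pd_koszul hU hG hx, pd_koszul hU hG hx, pd_comm hU (hG i k) k i hx]
    ring
  simp only [divergence, h1, h2, Finset.sum_sub_distrib]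
  rw [Finset.sum_comm (f := fun i k => 1 / 2 * pd k (pd k fun y => G y i i) x)]
  simp only [← Finset.mul_sum]
  ring

theorem PointBounds.abs_koszul_le (h : PointBounds G f x η d₁ d₂) (k i j : Fin n) :
    |koszul G k i j x| ≤ 3 * d₁ := by
  have h1 := abs_le.1 (h.pd_le i j k)
  have h2 := abs_le.1 (h.pd_le j i k)
  have h3 := abs_le.1 (h.pd_le k i j)
  rw [koszul, abs_le]
  constructor <;> linarith [h1.1, h1.2, h2.1, h2.2, h3.1, h3.2]

theorem PointBounds.abs_pd_koszul_le (h : PointBounds G f x η d₁ d₂) (hU : IsOpen U)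
    (hG : ∀ i j, ContDiffOn ℝ ∞ (fun y => G y i j) U) (hx : x ∈ U) (m k i j : Fin n) :
    |pd m (koszul G k i j) x| ≤ 3 * d₂ := by
  have h1 := abs_le.1 (h.pd_pd_le m i j k)
  have h2 := abs_le.1 (h.pd_pd_le m j i k)
  have h3 := abs_le.1 (h.pd_pd_le m k i j)
  rw [pd_koszul hU hG hx, abs_le]
  constructor <;> linarith [h1.1, h1.2, h2.1, h2.2, h3.1, h3.2]

theorem PointBounds.abs_christoffel_le (hn : 1 ≤ n) (h : PointBounds G f x η d₁ d₂)
    (k i j : Fin n) : |christoffel G k i j x| ≤ 3 * n * d₁ := by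
  have hinv := (inv_bounds_of_close_to_one hn h.small h.close).2.1
  rw [christoffel_eq]
  refine (abs_mul_le (c := 1 / 2) (by norm_num) (abs_sum_fin_le fun l =>
    abs_mul_le (hinv k l) (h.abs_koszul_le l i j))).trans (le_of_eq ?_)
  ring

/-- By the product rule, a derivative falling on the inverse metric gives `d₁²`, and replacing the
undifferentiated inverse by the identity costs `η d₂`. -/
theorem PointBounds.abs_pd_christoffel_sub_le (hn : 1 ≤ n) (h : PointBounds G f x η d₁ d₂)
    (hU : IsOpen U) (hG : ∀ i j, ContDiffOn ℝ ∞ (fun y => G y i j) U) (hx : x ∈ U)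
    (m k i j : Fin n) :
    |pd m (christoffel G k i j) x - 1 / 2 * pd m (koszul G k i j) x| ≤
      6 * n ^ 3 * (d₁ ^ 2 + η * d₂) := by
  obtain ⟨hdet, hinv, hclose⟩ := inv_bounds_of_close_to_one hn h.small h.close
  have hGd : ∀ i j, DifferentiableAt ℝ (fun y => G y i j) x := fun i j =>
    differentiableAt_of_contDiffOn hU (hG i j) hx
  have hHd := differentiableAt_inv_apply hGd hdet
  have hTd : ∀ l, DifferentiableAt ℝ (koszul G l i j) x := fun l =>
    differentiableAt_of_contDiffOn hU (contDiffOn_koszul hU hG l i j) hx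
  have e : pd m (christoffel G k i j) x = 1 / 2 * ∑ l, (pd m (fun y => (G y)⁻¹ k l) x *
      koszul G l i j x + (G x)⁻¹ k l * pd m (koszul G l i j) x) := by
    rw [christoffel_eq, pd_const_mul (DifferentiableAt.fun_sum fun l _ => (hHd k l).fun_mul (hTd l)),
      pd_sum fun l => (hHd k l).fun_mul (hTd l)]
    congr 1
    exact Finset.sum_congr rfl fun l _ => pd_mul (hHd k l) (hTd l) m
  have e2 : pd m (koszul G k i j) x =
      ∑ l, (1 : Matrix (Fin n) (Fin n) ℝ) k l * pd m (koszul G l i j) x := by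
    simp [Matrix.one_apply]
  have e3 : pd m (christoffel G k i j) x - 1 / 2 * pd m (koszul G k i j) x =
      1 / 2 * (∑ l, pd m (fun y => (G y)⁻¹ k l) x * koszul G l i j x +
        ∑ l, ((G x)⁻¹ k l - (1 : Matrix (Fin n) (Fin n) ℝ) k l) * pd m (koszul G l i j) x) := by
    rw [e, e2]
    simp only [sub_mul, Finset.sum_sub_distrib, Finset.sum_add_distrib]
    ring
  have hη : 0 ≤ η := (abs_nonneg _).trans h.weight_le
  have hd₂ : 0 ≤ d₂ := (abs_nonneg _).trans (h.pd_pd_weight_le m m)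
  have hn' : (1 : ℝ) ≤ n := by exact_mod_cast hn
  rw [e3]
  refine (abs_mul_le (c := 1 / 2) (by norm_num) ((abs_add_le _ _).trans (add_le_add
    (abs_sum_fin_le fun l => abs_mul_le (abs_pd_inv_le hGd hdet hinv m (h.pd_le m) k l)
      (h.abs_koszul_le l i j))
    (abs_sum_fin_le fun l => abs_mul_le (hclose k l)
      (h.abs_pd_koszul_le hU hG hx m l i j))))).trans ?_
  have h1 : (n : ℝ) ^ 2 ≤ 2 * n ^ 3 := by nlinarith [sq_nonneg (n : ℝ)]
  have h2 : 0 ≤ η * d₂ := mul_nonneg hη hd₂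
  nlinarith [mul_le_mul_of_nonneg_right h1 h2]

theorem PointBounds.abs_linearRicci_le (h : PointBounds G f x η d₁ d₂) (hU : IsOpen U)
    (hG : ∀ i j, ContDiffOn ℝ ∞ (fun y => G y i j) U) (hx : x ∈ U) (i j : Fin n) :
    |linearRicci G i j x| ≤ n * (3 * d₂) := by
  refine abs_sum_fin_le fun k => ?_
  have h1 := abs_le.1 (h.abs_pd_koszul_le hU hG hx k k i j)
  have h2 := abs_le.1 (h.abs_pd_koszul_le hU hG hx j k i k)
  rw [abs_le]
  constructor <;> linarith [h1.1, h1.2, h2.1, h2.2]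

/-- The terms `∂Γ` are linear up to quadratic errors, and the products `ΓΓ` are already quadratic in
first derivatives. -/
theorem PointBounds.abs_ricci_sub_le (hn : 1 ≤ n) (h : PointBounds G f x η d₁ d₂)
    (hU : IsOpen U) (hG : ∀ i j, ContDiffOn ℝ ∞ (fun y => G y i j) U) (hx : x ∈ U)
    (i j : Fin n) :
    |ricci G i j x - linearRicci G i j x| ≤ 30 * n ^ 4 * (d₁ ^ 2 + η * d₂) := by
  have hη : 0 ≤ η := (abs_nonneg _).trans h.weight_le
  have hd₂ : 0 ≤ d₂ := (abs_nonneg _).trans (h.pd_pd_weight_le i i)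
  rw [ricci, linearRicci, ← Finset.sum_sub_distrib]
  have hk : ∀ k, |pd k (christoffel G k i j) x - pd j (christoffel G k i k) x
      + ∑ l, (christoffel G k k l x * christoffel G l i j x
        - christoffel G k j l x * christoffel G l i k x) -
      (1 / 2 * pd k (koszul G k i j) x - 1 / 2 * pd j (koszul G k i k) x)| ≤
      30 * n ^ 3 * (d₁ ^ 2 + η * d₂) := by
    intro k
    have h1 := abs_le.1 (h.abs_pd_christoffel_sub_le hn hU hG hx k k i j)
    have h2 := abs_le.1 (h.abs_pd_christoffel_sub_le hn hU hG hx j k i k)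
    have h3 : |∑ l, (christoffel G k k l x * christoffel G l i j x
        - christoffel G k j l x * christoffel G l i k x)| ≤ n * (18 * n ^ 2 * d₁ ^ 2) := by
      refine abs_sum_fin_le fun l => ?_
      have h4 := abs_le.1 (abs_mul_le (h.abs_christoffel_le hn k k l)
        (h.abs_christoffel_le hn l i j))
      have h5 := abs_le.1 (abs_mul_le (h.abs_christoffel_le hn k j l)
        (h.abs_christoffel_le hn l i k))
      rw [abs_le]
      constructor <;> nlinarith [h4.1, h4.2, h5.1, h5.2]
    have h4 := abs_le.1 h3
    have h5 : 0 ≤ (n : ℝ) ^ 3 * (η * d₂) := by positivity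
    rw [abs_le]
    constructor <;> nlinarith [h1.1, h1.2, h2.1, h2.2, h4.1, h4.2]
  refine (abs_sum_fin_le hk).trans (le_of_eq ?_)
  ring

/-- The scalar curvature is the divergence of the ADM vector field up to quadratic terms. -/
theorem PointBounds.abs_divergence_admField_sub_scalarCurvature_le (hn : 1 ≤ n)
    (h : PointBounds G f x η d₁ d₂) (hU : IsOpen U)
    (hG : ∀ i j, ContDiffOn ℝ ∞ (fun y => G y i j) U) (hx : x ∈ U) :
    |divergence (admField G) x - scalarCurvature G x| ≤ 66 * n ^ 6 * (d₁ ^ 2 + η * d₂) := by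
  obtain ⟨-, hinv, hclose⟩ := inv_bounds_of_close_to_one hn h.small h.close
  have hn' : (1 : ℝ) ≤ n := by exact_mod_cast hn
  have hη : 0 ≤ η := (abs_nonneg _).trans h.weight_le
  have hd₂ : 0 ≤ d₂ := (abs_nonneg _).trans (h.pd_pd_weight_le ⟨0, hn⟩ ⟨0, hn⟩)
  have e1 : divergence (admField G) x =
      ∑ i, ∑ j, (1 : Matrix (Fin n) (Fin n) ℝ) i j * linearRicci G i j x := by
    rw [← sum_linearRicci hU hG hx]
    simp [Matrix.one_apply]
  -- Split `g^{ij} R_{ij} - δ^{ij} L_{ij}`, with `L` the linear part, as `g^{ij} (R_{ij} - L_{ij}) +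
  -- (g^{ij} - δ^{ij}) L_{ij}`; both terms are quadratic.
  have e2 : divergence (admField G) x - scalarCurvature G x =
      -(∑ i, ∑ j, ((G x)⁻¹ i j * (ricci G i j x - linearRicci G i j x) +
        ((G x)⁻¹ i j - (1 : Matrix (Fin n) (Fin n) ℝ) i j) * linearRicci G i j x)) := by
    rw [e1, scalarCurvature]
    simp only [mul_sub, sub_mul, Finset.sum_sub_distrib, Finset.sum_add_distrib]
    ring
  rw [e2, abs_neg]
  refine (abs_sum_fin_le fun i => abs_sum_fin_le fun j => (abs_add_le _ _).trans (add_le_add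
    (abs_mul_le (hinv i j) (h.abs_ricci_sub_le hn hU hG hx i j))
    (abs_mul_le (hclose i j) (h.abs_linearRicci_le hU hG hx i j)))).trans ?_
  have h1 : (n : ℝ) ^ 4 ≤ n ^ 6 := pow_le_pow_right₀ hn' (by norm_num)
  have h2 : 0 ≤ η * d₂ := mul_nonneg hη hd₂
  have h3 : 0 ≤ (n : ℝ) ^ 6 * d₁ ^ 2 := by positivity
  nlinarith [mul_le_mul_of_nonneg_right h1 h2]

/-- All discrepancies are quadratic: `e^{-f} - 1` and `g^{ij} - δ^{ij}` are of size `η` and multiply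
second derivatives; the remaining terms, `e^{-f} |∂f|²` and `Γ ∂f`, are products of first
derivatives. -/
theorem PointBounds.abs_divergence_weightField_sub_laplacian_le (hn : 1 ≤ n)
    (h : PointBounds G f x η d₁ d₂) (hU : IsOpen U) (hf : ContDiffOn ℝ ∞ f U) (hx : x ∈ U) :
    |divergence (weightField f) x - laplacian G f x| ≤ 10 * n ^ 4 * (d₁ ^ 2 + η * d₂) := by
  obtain ⟨-, hinv, hclose⟩ := inv_bounds_of_close_to_one hn h.small h.close
  have hn' : (1 : ℝ) ≤ n := by exact_mod_cast hn
  have hη : 0 ≤ η := (abs_nonneg _).trans h.weight_le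
  have hη2 : 2 * η ≤ 1 := by nlinarith [h.small]
  have hd₂ : 0 ≤ d₂ := (abs_nonneg _).trans (h.pd_pd_weight_le ⟨0, hn⟩ ⟨0, hn⟩)
  have hfd : DifferentiableAt ℝ f x := differentiableAt_of_contDiffOn hU hf hx
  have e1 : ∀ i, pd i (weightField f i) x =
      (pd i (pd i f) x - pd i f x * pd i f x) * Real.exp (-(f x)) := by
    intro i
    unfold weightField
    rw [pd_mul (differentiableAt_of_contDiffOn hU (contDiffOn_pd hU hf i) hx)
      (hfd.fun_neg.exp), pd_exp_neg hfd]
    ring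
  have hexp : |Real.exp (-(f x)) - 1| ≤ 2 * η := by
    have h1 : |-(f x)| ≤ 1 := by
      rw [abs_neg]; linarith [h.weight_le]
    refine (Real.abs_exp_sub_one_le h1).trans ?_
    rw [abs_neg]
    linarith [h.weight_le]
  have hexp2 : |Real.exp (-(f x))| ≤ 2 := by
    have := abs_le.1 hexp
    rw [abs_of_pos (Real.exp_pos _)]
    linarith [this.2]
  have e2 : divergence (weightField f) x - laplacian G f x =
      (∑ i, ((Real.exp (-(f x)) - 1) * pd i (pd i f) x -
        Real.exp (-(f x)) * (pd i f x * pd i f x))) -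
      ∑ i, ∑ j, (((G x)⁻¹ i j - (1 : Matrix (Fin n) (Fin n) ℝ) i j) * pd i (pd j f) x -
        (G x)⁻¹ i j * ∑ k, christoffel G k i j x * pd k f x) := by
    have e3 : ∑ i, pd i (pd i f) x =
        ∑ i, ∑ j, (1 : Matrix (Fin n) (Fin n) ℝ) i j * pd i (pd j f) x := by
      simp [Matrix.one_apply]
    simp only [divergence, laplacian, e1, mul_sub, sub_mul, Finset.sum_sub_distrib, one_mul, e3]
    simp only [mul_comm]
    ring
  rw [e2]
  refine (abs_sub _ _).trans ((add_le_add
    (abs_sum_fin_le fun i => (abs_sub _ _).trans (add_le_add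
      (abs_mul_le hexp (h.pd_pd_weight_le i i))
      (abs_mul_le hexp2 (abs_mul_le (h.pd_weight_le i) (h.pd_weight_le i)))))
    (abs_sum_fin_le fun i => abs_sum_fin_le fun j => (abs_sub _ _).trans (add_le_add
      (abs_mul_le (hclose i j) (h.pd_pd_weight_le i j))
      (abs_mul_le (hinv i j) (abs_sum_fin_le fun k =>
        abs_mul_le (h.abs_christoffel_le hn k i j) (h.pd_weight_le k)))))).trans ?_)
  have h1 : (n : ℝ) ≤ n ^ 4 := le_self_pow₀ hn' (by norm_num)
  have h2 : (n : ℝ) ^ 3 ≤ n ^ 4 := pow_le_pow_right₀ hn' (by norm_num)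
  have h3 : 0 ≤ η * d₂ := mul_nonneg hη hd₂
  have h4 : 0 ≤ d₁ ^ 2 := sq_nonneg _
  nlinarith [mul_le_mul_of_nonneg_right h1 h3, mul_le_mul_of_nonneg_right h2 h3,
    mul_le_mul_of_nonneg_right h1 h4, mul_nonneg (pow_nonneg (zero_le_one.trans hn') 4) h3]

theorem PointBounds.abs_gradSq_le (hn : 1 ≤ n) (h : PointBounds G f x η d₁ d₂) :
    |gradSq G f x| ≤ 2 * n ^ 2 * d₁ ^ 2 := by
  have hinv := (inv_bounds_of_close_to_one hn h.small h.close).2.1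
  refine (abs_sum_fin_le fun i => abs_sum_fin_le fun j => abs_mul_le (hinv i j)
    (abs_mul_le (h.pd_weight_le i) (h.pd_weight_le j))).trans (le_of_eq ?_)
  ring

/-- `P(g,f)` is the divergence of the vector field of the weighted mass up to quadratic terms. -/
theorem PointBounds.abs_divergence_sub_pScalarCurvature_le (hn : 1 ≤ n)
    (h : PointBounds G f x η d₁ d₂) (hU : IsOpen U)
    (hG : ∀ i j, ContDiffOn ℝ ∞ (fun y => G y i j) U) (hf : ContDiffOn ℝ ∞ f U) (hx : x ∈ U) :
    |divergence (admField G) x + 2 * divergence (weightField f) x - pScalarCurvature G f x| ≤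
      88 * n ^ 6 * (d₁ ^ 2 + η * d₂) := by
  have hn' : (1 : ℝ) ≤ n := by exact_mod_cast hn
  have hη : 0 ≤ η := (abs_nonneg _).trans h.weight_le
  have hd₂ : 0 ≤ d₂ := (abs_nonneg _).trans (h.pd_pd_weight_le ⟨0, hn⟩ ⟨0, hn⟩)
  have h1 := abs_le.1 (h.abs_divergence_admField_sub_scalarCurvature_le hn hU hG hx)
  have h2 := abs_le.1 (h.abs_divergence_weightField_sub_laplacian_le hn hU hf hx)
  have h3 := abs_le.1 (h.abs_gradSq_le hn)
  have h4 : 0 ≤ d₁ ^ 2 + η * d₂ := by positivity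
  have h5 : (n : ℝ) ^ 4 * (d₁ ^ 2 + η * d₂) ≤ n ^ 6 * (d₁ ^ 2 + η * d₂) :=
    mul_le_mul_of_nonneg_right (pow_le_pow_right₀ hn' (by norm_num)) h4
  have h6 : (n : ℝ) ^ 2 * d₁ ^ 2 ≤ n ^ 6 * (d₁ ^ 2 + η * d₂) :=
    mul_le_mul (pow_le_pow_right₀ hn' (by norm_num)) (by nlinarith) (sq_nonneg _) (by positivity)
  rw [pScalarCurvature, abs_le]
  constructor <;> linarith [h1.1, h1.2, h2.1, h2.2, h3.1, h3.2]

end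

end CurvatureExpansion

/-! ### Estimates on an end: tails, integrability, and fluxes through one sphere. -/

section MassOfEnd

open Metric

variable {n : ℕ}

/-- The decay of the metric and of the weight in the coordinates of an end. -/
structure EndBounds (τ K : ℝ) (G : Euc n → Matrix (Fin n) (Fin n) ℝ) (f : Euc n → ℝ) :
    Prop where
  metric : ∀ i j, DecayBound τ K fun x => G x i j - (1 : Matrix (Fin n) (Fin n) ℝ) i j
  weight : DecayBound τ K f

/-- The sum of the absolute values of all second derivatives. -/
def sndDerivSum (G : Euc n → Matrix (Fin n) (Fin n) ℝ) (f : Euc n → ℝ) (x : Euc n) : ℝ :=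
  (∑ q : (Fin n × Fin n) × (Fin n × Fin n), |pd q.1.1 (pd q.1.2 fun y => G y q.2.1 q.2.2) x|) +
    ∑ q : Fin n × Fin n, |pd q.1 (pd q.2 f) x|

/-- The quadratic error in the expansion of the curvature. -/
def quadError (τ K : ℝ) (G : Euc n → Matrix (Fin n) (Fin n) ℝ) (f : Euc n → ℝ) (x : Euc n) : ℝ :=
  (K * ‖x‖ ^ (-τ - 1)) ^ 2 + K * ‖x‖ ^ (-τ) * sndDerivSum G f x

theorem pd_sub_const (u : Euc n → ℝ) (c : ℝ) (i : Fin n) : pd i (fun y => u y - c) = pd i u := by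
  funext x
  rw [pd, fderiv_sub_const]
  rfl

theorem measurable_sndDerivSum (G : Euc n → Matrix (Fin n) (Fin n) ℝ) (f : Euc n → ℝ) :
    Measurable (sndDerivSum G f) :=
  (Finset.measurable_sum _ fun _ _ => (measurable_pd _ _).norm).add
    (Finset.measurable_sum _ fun _ _ => (measurable_pd _ _).norm)

theorem measurable_quadError (τ K : ℝ) (G : Euc n → Matrix (Fin n) (Fin n) ℝ) (f : Euc n → ℝ) :
    Measurable (quadError τ K G f) :=
  (((measurable_norm.pow_const _).const_mul K).pow_const 2).add
    (((measurable_norm.pow_const _).const_mul K).mul (measurable_sndDerivSum G f))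

theorem sndDerivSum_nonneg (G : Euc n → Matrix (Fin n) (Fin n) ℝ) (f : Euc n → ℝ) (x : Euc n) :
    0 ≤ sndDerivSum G f x :=
  add_nonneg (Finset.sum_nonneg fun _ _ => abs_nonneg _) (Finset.sum_nonneg fun _ _ => abs_nonneg _)

theorem quadError_nonneg {τ K : ℝ} (hK : 0 ≤ K) (G : Euc n → Matrix (Fin n) (Fin n) ℝ)
    (f : Euc n → ℝ) (x : Euc n) : 0 ≤ quadError τ K G f x :=
  add_nonneg (sq_nonneg _) (mul_nonneg (by positivity) (sndDerivSum_nonneg G f x))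

section

variable {τ K : ℝ} {G : Euc n → Matrix (Fin n) (Fin n) ℝ} {f : Euc n → ℝ}

theorem EndBounds.contDiffOn_metric (h : EndBounds τ K G f) (i j : Fin n) :
    ContDiffOn ℝ ∞ (fun y => G y i j) (exterior n) := by
  have := (h.metric i j).smooth.add
    (contDiffOn_const (c := (1 : Matrix (Fin n) (Fin n) ℝ) i j))
  simpa using this

/-- The radius depends only on `n`, `τ`, `K`, so one radius serves both pairs. Second derivatives
have no pointwise decay, only an integral bound, so their bound is the function `sndDerivSum`
itself. -/
theorem exists_pointBounds (hτ : 0 < τ) (K : ℝ) :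
    ∃ r₀ : ℝ, 2 ≤ r₀ ∧ ∀ (G : Euc n → Matrix (Fin n) (Fin n) ℝ) (f : Euc n → ℝ),
      EndBounds τ K G f → ∀ x, r₀ ≤ ‖x‖ →
        PointBounds G f x (K * ‖x‖ ^ (-τ)) (K * ‖x‖ ^ (-τ - 1)) (sndDerivSum G f x) := by
  have ht : Tendsto (fun r : ℝ => 2 * n * (K * r ^ (-τ))) atTop (𝓝 0) := by
    have := ((tendsto_rpow_neg_atTop hτ).const_mul K).const_mul (2 * n : ℝ)
    simpa using this
  obtain ⟨r₁, hr₁⟩ := eventually_atTop.1 (ht.eventually (ge_mem_nhds (show (0 : ℝ) < 1 by norm_num)))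
  refine ⟨max 2 r₁, le_max_left _ _, fun G f h x hx => ?_⟩
  have hx2 : 2 ≤ ‖x‖ := (le_max_left _ _).trans hx
  refine ⟨hr₁ _ ((le_max_right _ _).trans hx), fun i j => (h.metric i j).abs_le x hx2,
    fun k i j => ?_, fun k l i j => ?_, h.weight.abs_le x hx2, fun k => h.weight.abs_pd_le k x hx2,
    fun k l => ?_⟩
  · have := (h.metric i j).abs_pd_le k x hx2
    rwa [pd_sub_const (fun y => G y i j)] at this
  · refine le_add_of_le_of_nonneg ?_ (Finset.sum_nonneg fun _ _ => abs_nonneg _)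
    exact Finset.single_le_sum (f := fun q : (Fin n × Fin n) × (Fin n × Fin n) =>
      |pd q.1.1 (pd q.1.2 fun y => G y q.2.1 q.2.2) x|) (fun _ _ => abs_nonneg _)
      (Finset.mem_univ ((k, l), (i, j)))
  · refine le_add_of_nonneg_of_le (Finset.sum_nonneg fun _ _ => abs_nonneg _) ?_
    exact Finset.single_le_sum (f := fun q : Fin n × Fin n =>
      |pd q.1 (pd q.2 f) x|) (fun _ _ => abs_nonneg _) (Finset.mem_univ (k, l))

/-- There are `n⁴` second derivatives of metric components and `n²` of the weight, each with
integral at most `K`. -/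
theorem EndBounds.lintegral_sndDerivSum_le (h : EndBounds τ K G f) :
    ∫⁻ x in exterior n, ENNReal.ofReal (‖x‖ ^ (1 - n / 2 : ℝ)) *
      ENNReal.ofReal (sndDerivSum G f x) ≤ (n ^ 4 + n ^ 2) * ENNReal.ofReal K := by
  have e : ∀ x, ENNReal.ofReal (‖x‖ ^ (1 - n / 2 : ℝ)) * ENNReal.ofReal (sndDerivSum G f x) =
      (∑ q : (Fin n × Fin n) × (Fin n × Fin n), ENNReal.ofReal (‖x‖ ^ (1 - n / 2 : ℝ)) *
        ‖pd q.1.1 (pd q.1.2 fun y => G y q.2.1 q.2.2) x‖ₑ) +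
      ∑ q : Fin n × Fin n, ENNReal.ofReal (‖x‖ ^ (1 - n / 2 : ℝ)) * ‖pd q.1 (pd q.2 f) x‖ₑ := by
    intro x
    rw [sndDerivSum, ENNReal.ofReal_add (Finset.sum_nonneg fun _ _ => abs_nonneg _)
      (Finset.sum_nonneg fun _ _ => abs_nonneg _),
      ENNReal.ofReal_sum_of_nonneg fun _ _ => abs_nonneg _,
      ENNReal.ofReal_sum_of_nonneg fun _ _ => abs_nonneg _, mul_add, Finset.mul_sum, Finset.mul_sum]
    simp only [← Real.enorm_eq_ofReal_abs]
  have hm : ∀ (a b : Fin n) (u : Euc n → ℝ), Measurable fun x : Euc n =>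
      ENNReal.ofReal (‖x‖ ^ (1 - n / 2 : ℝ)) * ‖pd a (pd b u) x‖ₑ := fun a b u =>
    (measurable_ofReal_norm_rpow _).mul (measurable_pd a _).enorm
  simp only [e]
  rw [lintegral_add_left (Finset.measurable_sum _ fun q _ => hm _ _ _),
    lintegral_finsetSum _ fun q _ => hm _ _ _, lintegral_finsetSum _ fun q _ => hm _ _ _, add_mul]
  refine add_le_add
    ((Finset.sum_le_sum (g := fun _ => ENNReal.ofReal K) fun q _ => ?_).trans (le_of_eq ?_))
    ((Finset.sum_le_sum fun q _ => h.weight.lintegral_pd_pd_le q.1 q.2).trans (le_of_eq ?_))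
  · have := (h.metric q.2.1 q.2.2).lintegral_pd_pd_le q.1.1 q.1.2
    rwa [pd_sub_const (fun y => G y q.2.1 q.2.2)] at this
  · simp only [Finset.sum_const, Finset.card_univ, Fintype.card_prod, Fintype.card_fin,
      nsmul_eq_mul]
    push_cast
    ring
  · simp only [Finset.sum_const, Finset.card_univ, Fintype.card_prod, Fintype.card_fin,
      nsmul_eq_mul]
    push_cast
    ring

theorem measurableSet_lt_norm (r : ℝ) : MeasurableSet {x : Euc n | r < ‖x‖} :=
  measurableSet_lt measurable_const measurable_norm

theorem lt_norm_subset_exterior {r : ℝ} (hr : 1 ≤ r) : {x : Euc n | r < ‖x‖} ⊆ exterior n :=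
  fun _ hx => lt_of_le_of_lt hr hx

/-- The quadratic error is integrable, with a decaying tail. -/
theorem exists_lintegral_quadError_le (hτ : ((n : ℝ) - 2) / 2 < τ) {K : ℝ} (hK : 0 ≤ K) :
    ∃ C : ℝ≥0∞, C ≠ ⊤ ∧ ∀ (G : Euc n → Matrix (Fin n) (Fin n) ℝ) (f : Euc n → ℝ),
      EndBounds τ K G f → ∀ r : ℝ, 1 ≤ r →
        ∫⁻ x in {x : Euc n | r < ‖x‖}, ENNReal.ofReal (quadError τ K G f x) ≤
          C * ENNReal.ofReal (r ^ (-(τ + 1 - n / 2))) := by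
  set β : ℝ := τ + 1 - n / 2 with hβ
  have hβ0 : 0 < β := by rw [hβ]; linarith
  set J : ℝ≥0∞ := ∫⁻ x in exterior n, ENNReal.ofReal (‖x‖ ^ (-(n + β)))
  have hJ : J < ⊤ := lintegral_exterior_rpow_lt_top (by linarith)
  refine ⟨ENNReal.ofReal (K ^ 2) * J +
    ENNReal.ofReal K * ((n ^ 4 + n ^ 2) * ENNReal.ofReal K), by finiteness, fun G f h r hr => ?_⟩
  have hr0 : 0 < r := by linarith
  have key : ∀ x ∈ {x : Euc n | r < ‖x‖}, ENNReal.ofReal (quadError τ K G f x) ≤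
      ENNReal.ofReal (r ^ (-β)) * (ENNReal.ofReal (K ^ 2) * ENNReal.ofReal (‖x‖ ^ (-(n + β))) +
        ENNReal.ofReal K * (ENNReal.ofReal (‖x‖ ^ (1 - n / 2 : ℝ)) *
          ENNReal.ofReal (sndDerivSum G f x))) := by
    intro x hx
    have hrx : r < ‖x‖ := hx
    have hx0 : 0 < ‖x‖ := by linarith
    have hs := sndDerivSum_nonneg G f x
    rw [← ENNReal.ofReal_mul (by positivity), ← ENNReal.ofReal_mul (by positivity),
      ← ENNReal.ofReal_mul (by positivity), ← ENNReal.ofReal_add (by positivity) (by positivity),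
      ← ENNReal.ofReal_mul (by positivity)]
    refine ENNReal.ofReal_le_ofReal ?_
    have h1 : ‖x‖ ^ (-β) ≤ r ^ (-β) :=
      Real.rpow_le_rpow_of_nonpos hr0 hrx.le (by linarith)
    -- A factor `|x|^{-β} ≤ r^{-β}` is extracted from each term: `2τ + 2 = n + 2β` leaves an
    -- integrable power, and `-τ = -β + (1 - n/2)` leaves the weight for the second derivatives.
    have e1 : (‖x‖ ^ (-τ - 1)) ^ 2 = ‖x‖ ^ (-β) * ‖x‖ ^ (-(n + β)) := by
      rw [← Real.rpow_natCast, ← Real.rpow_mul hx0.le, ← Real.rpow_add hx0]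
      congr 1
      rw [hβ]; push_cast; ring
    have e2 : ‖x‖ ^ (-τ) = ‖x‖ ^ (-β) * ‖x‖ ^ (1 - n / 2 : ℝ) := by
      rw [← Real.rpow_add hx0]
      congr 1
      rw [hβ]; ring
    rw [quadError, mul_pow, e1, e2]
    calc K ^ 2 * (‖x‖ ^ (-β) * ‖x‖ ^ (-(n + β))) +
          K * (‖x‖ ^ (-β) * ‖x‖ ^ (1 - n / 2 : ℝ)) * sndDerivSum G f x
        = ‖x‖ ^ (-β) * (K ^ 2 * ‖x‖ ^ (-(n + β)) +
          K * (‖x‖ ^ (1 - n / 2 : ℝ) * sndDerivSum G f x)) := by ring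
      _ ≤ _ := by gcongr
  refine (setLIntegral_mono' (measurableSet_lt_norm r) key).trans ?_
  rw [lintegral_const_mul' _ _ ENNReal.ofReal_ne_top, lintegral_add_left
    ((measurable_ofReal_norm_rpow _).const_mul _), lintegral_const_mul' _ _ ENNReal.ofReal_ne_top,
    lintegral_const_mul' _ _ ENNReal.ofReal_ne_top, mul_comm]
  gcongr
  · exact lintegral_mono_set (lt_norm_subset_exterior hr)
  · exact (lintegral_mono_set (lt_norm_subset_exterior hr)).trans h.lintegral_sndDerivSum_le

/-- A function of `L^∞_{-2τ-2}` is integrable on an end. -/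
theorem lintegral_lt_top_of_weightedNorm_top (hτ : ((n : ℝ) - 2) / 2 < τ) {w : Euc n → ℝ}
    (hw : weightedNorm 0 ⊤ (-2 * τ - 2) w < ⊤) : ∫⁻ x in exterior n, ‖w x‖ₑ < ⊤ := by
  set N : ℝ≥0∞ := eLpNorm (fun x => w x * ‖x‖ ^ (2 * τ + 2)) ⊤ (scaleMeasure n) with hN
  have hNt : N < ⊤ := by
    refine lt_of_le_of_lt ?_ hw
    have := eLpNorm_pdList_le_weightedNorm (k := 0) (m := 0) le_rfl
      (I := Fin.elim0) (fun a => a.elim0) ⊤ (-2 * τ - 2) w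
    have e : 2 * τ + 2 = ((0 : ℕ) : ℝ) - (-2 * τ - 2) := by push_cast; ring
    rw [hN, e]
    exact this
  have hae : ∀ᵐ x ∂volume.restrict (exterior n), ‖w x * ‖x‖ ^ (2 * τ + 2)‖ₑ ≤ N := by
    have h1 : ∀ᵐ x ∂scaleMeasure n, ‖w x * ‖x‖ ^ (2 * τ + 2)‖ₑ ≤ N := by
      rw [hN, eLpNorm_exponent_top]
      exact enorm_ae_le_eLpNormEssSup _ _
    -- The density `|x|^{-n}` is positive, so an almost everywhere statement for the scale-invariant
    -- measure also holds for Lebesgue measure.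
    refine (withDensity_absolutelyContinuous' (measurable_ofReal_norm_rpow _).aemeasurable
      (ae_restrict_of_forall_mem isOpen_exterior.measurableSet fun x hx => ?_)).ae_le h1
    have hx0 : 0 < ‖x‖ := lt_trans one_pos hx
    rw [ne_eq, ENNReal.ofReal_eq_zero, not_le]
    exact Real.rpow_pos_of_pos hx0 _
  calc ∫⁻ x in exterior n, ‖w x‖ₑ
      ≤ ∫⁻ x in exterior n, N * ENNReal.ofReal (‖x‖ ^ (-(2 * τ + 2))) := by
        refine lintegral_mono_ae ?_
        filter_upwards [hae, ae_restrict_mem isOpen_exterior.measurableSet] with x h1 hx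
        have hx0 : 0 < ‖x‖ := lt_trans one_pos hx
        have e : w x = w x * ‖x‖ ^ (2 * τ + 2) * ‖x‖ ^ (-(2 * τ + 2)) := by
          rw [mul_assoc, ← Real.rpow_add hx0]; simp
        rw [e, enorm_mul, Real.enorm_of_nonneg (show 0 ≤ ‖x‖ ^ (-(2 * τ + 2)) by positivity)]
        gcongr
    _ = N * ∫⁻ x in exterior n, ENNReal.ofReal (‖x‖ ^ (-(2 * τ + 2))) :=
        lintegral_const_mul' _ _ hNt.ne
    _ < ⊤ := ENNReal.mul_lt_top hNt (lintegral_exterior_rpow_lt_top (by linarith))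

theorem continuousOn_divergence {V : Fin n → Euc n → ℝ}
    (hV : ∀ i, ContDiffOn ℝ ∞ (V i) (exterior n)) : ContinuousOn (divergence V) (exterior n) :=
  continuousOn_finsetSum _ fun i _ => (contDiffOn_pd isOpen_exterior (hV i) i).continuousOn

/-- Used with `w` the scalar curvature or the Laplacian and `e` the quadratic error: each half of
the mass converges separately, as its definition demands. -/
theorem integrableOn_divergence {V : Fin n → Euc n → ℝ}
    (hV : ∀ i, ContDiffOn ℝ ∞ (V i) (exterior n)) {r : ℝ} (hr : 1 ≤ r) {w e : Euc n → ℝ} {c : ℝ}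
    (hw : ∫⁻ x in exterior n, ‖w x‖ₑ < ⊤) (he : Measurable e)
    (he' : ∫⁻ x in {x : Euc n | r < ‖x‖}, ENNReal.ofReal (e x) < ⊤) (hc : 0 ≤ c)
    (hle : ∀ x, r < ‖x‖ → |divergence V x - w x| ≤ c * e x) :
    IntegrableOn (divergence V) {x : Euc n | r < ‖x‖} := by
  have hsub := lt_norm_subset_exterior (n := n) hr
  refine ⟨((continuousOn_divergence hV).mono hsub).aestronglyMeasurable
    (measurableSet_lt_norm r), ?_⟩
  calc ∫⁻ x in {x : Euc n | r < ‖x‖}, ‖divergence V x‖ₑ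
      ≤ ∫⁻ x in {x : Euc n | r < ‖x‖}, (‖w x‖ₑ + ENNReal.ofReal c * ENNReal.ofReal (e x)) := by
        refine setLIntegral_mono' (measurableSet_lt_norm r) fun x hx => ?_
        have e1 : divergence V x = w x + (divergence V x - w x) := by ring
        rw [e1]
        refine (enorm_add_le _ _).trans (add_le_add le_rfl ?_)
        rw [Real.enorm_eq_ofReal_abs, ← ENNReal.ofReal_mul hc]
        exact ENNReal.ofReal_le_ofReal (hle x hx)
    _ = (∫⁻ x in {x : Euc n | r < ‖x‖}, ‖w x‖ₑ) +
          ENNReal.ofReal c * ∫⁻ x in {x : Euc n | r < ‖x‖}, ENNReal.ofReal (e x) := by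
        rw [lintegral_add_right _ (he.ennreal_ofReal.const_mul _),
          lintegral_const_mul' _ _ ENNReal.ofReal_ne_top]
    _ < ⊤ := ENNReal.add_lt_top.2 ⟨(lintegral_mono_set hsub).trans_lt hw,
        ENNReal.mul_lt_top ENNReal.ofReal_lt_top he'⟩

end

/-! ### Comparison of fluxes through a fixed sphere -/

theorem abs_flux_sub_flux_le {V W : Fin n → Euc n → ℝ}
    (hV : ∀ i, ContDiffOn ℝ ∞ (V i) (exterior n)) (hW : ∀ i, ContDiffOn ℝ ∞ (W i) (exterior n))
    {r c : ℝ} (hr : 1 < r) (h : ∀ i x, ‖x‖ = r → |V i x - W i x| ≤ c) :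
    |flux V r - flux W r| ≤ r ^ (n - 1) * (n * c * sphereVolume n) := by
  have hr0 : 0 < r := by linarith
  have hint : ∀ {V : Fin n → Euc n → ℝ}, (∀ i, ContDiffOn ℝ ∞ (V i) (exterior n)) →
      Integrable (fun ν : sphere (0 : Euc n) 1 => ∑ i, V i (r • (ν : Euc n)) * (ν : Euc n) i)
        (volume : Measure (Euc n)).toSphere := by
    intro V hV
    refine Continuous.integrable_of_hasCompactSupport ?_ (HasCompactSupport.of_compactSpace _)
    exact (continuousOn_uncurry_sum_mul fun i => (hV i).continuousOn).comp_continuous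
      (f := fun ν : sphere (0 : Euc n) 1 => ((r • (ν : Euc n), (ν : Euc n)) : Euc n × Euc n))
      (by fun_prop) fun ν => ⟨smul_sphere_mem_exterior hr ν, mem_univ _⟩
  simp only [flux, sphereIntegral]
  rw [← mul_sub, ← integral_sub (hint hV) (hint hW), abs_mul, abs_of_pos (by positivity)]
  gcongr
  rw [sphereVolume, ← Real.norm_eq_abs]
  refine norm_integral_le_of_norm_le_const (ae_of_all _ fun ν => ?_)
  rw [Real.norm_eq_abs, ← Finset.sum_sub_distrib]
  refine abs_sum_fin_le fun i => ?_
  rw [← sub_mul]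
  have h1 : |(ν : Euc n) i| ≤ 1 := by
    have := PiLp.norm_apply_le (ν : Euc n) i
    rwa [norm_eq_of_mem_sphere, Real.norm_eq_abs] at this
  have h2 := h i (r • (ν : Euc n)) (by
    rw [norm_smul, norm_eq_of_mem_sphere, Real.norm_of_nonneg hr0.le, mul_one])
  simpa using abs_mul_le h2 h1

theorem abs_admField_sub_le {G Gh : Euc n → Matrix (Fin n) (Fin n) ℝ} {x : Euc n} {d : ℝ}
    (hG : ∀ i j, DifferentiableAt ℝ (fun y => G y i j) x)
    (hGh : ∀ i j, DifferentiableAt ℝ (fun y => Gh y i j) x)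
    (h : ∀ k i j, |pd k (fun y => Gh y i j - G y i j) x| ≤ d) (i : Fin n) :
    |admField G i x - admField Gh i x| ≤ n * (2 * d) := by
  rw [admField, admField, ← Finset.sum_sub_distrib]
  refine abs_sum_fin_le fun j => ?_
  have h1 := h j i j
  have h2 := h i j j
  rw [pd_sub (hGh _ _) (hG _ _), abs_le] at h1 h2
  rw [abs_le]
  constructor <;> linarith [h1.1, h1.2, h2.1, h2.2]

/-- Change the gradient first and the exponential second: `e^{-f} ≤ 2` and `|e^{f - f̂} - 1| ≤ 2d`
give `2d + K · 2 · 2d`. -/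
theorem abs_weightField_sub_le {f fh : Euc n → ℝ} {x : Euc n} {d K : ℝ}
    (hf : DifferentiableAt ℝ f x) (hfh : DifferentiableAt ℝ fh x)
    (h0 : |f x| ≤ 1 / 2) (h0' : |fh x| ≤ 1 / 2) (hd : |fh x - f x| ≤ d)
    (h : ∀ k, |pd k (fun y => fh y - f y) x| ≤ d) (hK : ∀ k, |pd k fh x| ≤ K) (i : Fin n) :
    |weightField f i x - weightField fh i x| ≤ (2 + 4 * K) * d := by
  have hd0 : 0 ≤ d := (abs_nonneg _).trans hd
  have e : weightField f i x - weightField fh i x =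
      -(pd i (fun y => fh y - f y) x * Real.exp (-(f x))) -
        pd i fh x * (Real.exp (-(f x)) * (Real.exp (f x - fh x) - 1)) := by
    have : Real.exp (-(fh x)) = Real.exp (-(f x)) * Real.exp (f x - fh x) := by
      rw [← Real.exp_add]; congr 1; ring
    rw [weightField, weightField, pd_sub hfh hf, this]
    ring
  have hexp : |Real.exp (-(f x))| ≤ 2 := by
    have h1 := Real.abs_exp_sub_one_le (x := -(f x)) (by rw [abs_neg]; linarith)
    rw [abs_neg] at h1
    rw [abs_of_pos (Real.exp_pos _)]
    linarith [(abs_le.1 h1).2]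
  have hexp' : |Real.exp (f x - fh x) - 1| ≤ 2 * d := by
    have h1 : |f x - fh x| ≤ 1 := (abs_sub _ _).trans (by linarith)
    refine (Real.abs_exp_sub_one_le h1).trans ?_
    rw [abs_sub_comm]
    linarith
  rw [e]
  refine (abs_sub _ _).trans ?_
  rw [abs_neg]
  refine (add_le_add (abs_mul_le (h i) hexp)
    (abs_mul_le (hK i) (abs_mul_le hexp hexp'))).trans (le_of_eq ?_)
  ring

end MassOfEnd

/-! ### Comparison of two masses on an end. -/

section MassComparison

open Metric

variable {n : ℕ}

/-- The decay is discarded, since on the fixed sphere only a `C¹` bound matters. -/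
theorem DecayBound.abs_le_const {τ K : ℝ} (hτ : 0 < τ) (hK : 0 ≤ K) {u : Euc n → ℝ}
    (hu : DecayBound τ K u) {x : Euc n} (hx : 2 ≤ ‖x‖) : |u x| ≤ K ∧ ∀ i, |pd i u x| ≤ K := by
  have h1 : ∀ e : ℝ, e ≤ 0 → K * ‖x‖ ^ e ≤ K := fun e he =>
    mul_le_of_le_one_right hK (Real.rpow_le_one_of_one_le_of_nonpos (by linarith) he)
  exact ⟨(hu.abs_le x hx).trans (h1 _ (by linarith)),
    fun i => (hu.abs_pd_le i x hx).trans (h1 _ (by linarith))⟩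

/-- Outside radius `r` one has `r^β ≤ |x|^β ≤ |x|^{2β}`. The weaker rate `r^{-β}` is kept because it
matches the rate of the quadratic error. -/
theorem lintegral_tail_le {β : ℝ} (hβ : 0 < β) (w : Euc n → ℝ) {r : ℝ} (hr : 1 ≤ r) :
    ∫⁻ x in {x : Euc n | r < ‖x‖}, ‖w x‖ₑ ≤
      (∫⁻ x in exterior n, ENNReal.ofReal (‖x‖ ^ (2 * β)) * ‖w x‖ₑ) *
        ENNReal.ofReal (r ^ (-β)) := by
  have hr0 : 0 < r := by linarith
  rw [← lintegral_mul_const' _ _ ENNReal.ofReal_ne_top]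
  refine (setLIntegral_mono' (measurableSet_lt_norm r) fun x hx => ?_).trans
    (lintegral_mono_set (lt_norm_subset_exterior hr))
  have hrx : r < ‖x‖ := hx
  have h1 : 1 ≤ ‖x‖ ^ (2 * β) * r ^ (-β) := by
    rw [Real.rpow_neg hr0.le, ← div_eq_mul_inv, one_le_div (by positivity)]
    exact (Real.rpow_le_rpow hr0.le hrx.le hβ.le).trans
      (Real.rpow_le_rpow_of_exponent_le (by linarith) (by linarith))
  calc ‖w x‖ₑ = 1 * ‖w x‖ₑ := (one_mul _).symm
    _ ≤ ENNReal.ofReal (‖x‖ ^ (2 * β) * r ^ (-β)) * ‖w x‖ₑ := by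
        gcongr
        rwa [ENNReal.one_le_ofReal]
    _ = _ := by
        rw [ENNReal.ofReal_mul (Real.rpow_nonneg (norm_nonneg x) _)]
        ring

/-- Continuity of the weighted mass, in the coordinates of an end. -/
theorem exists_abs_mass_sub_lt (hn : 1 ≤ n) {τ : ℝ} (hτ0 : 0 < τ)
    (hτ : ((n : ℝ) - 2) / 2 < τ) {K : ℝ} (hK : 0 ≤ K) (c : ℝ≥0) {ε : ℝ} (hε : 0 < ε) :
    ∃ δ : ℝ, 0 < δ ∧ ∀ (G Gh : Euc n → Matrix (Fin n) (Fin n) ℝ) (f fh : Euc n → ℝ),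
      EndBounds τ K G f → EndBounds τ K Gh fh →
      (∀ i j, DecayBound τ δ fun x => Gh x i j - G x i j) →
      DecayBound τ δ (fun x => fh x - f x) →
      ∫⁻ x in exterior n, ‖scalarCurvature G x‖ₑ < ⊤ →
      ∫⁻ x in exterior n, ‖scalarCurvature Gh x‖ₑ < ⊤ →
      ∫⁻ x in exterior n, ‖laplacian G f x‖ₑ < ⊤ →
      ∫⁻ x in exterior n, ‖laplacian Gh fh x‖ₑ < ⊤ →
      ∫⁻ x in exterior n, ENNReal.ofReal (‖x‖ ^ (2 * (τ + 1 - n / 2))) *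
        ‖pScalarCurvature G f x - pScalarCurvature Gh fh x‖ₑ ≤ c →
      ∃ A Ah L Lh : ℝ, Tendsto (flux (admField G)) atTop (𝓝 A) ∧
        Tendsto (flux (admField Gh)) atTop (𝓝 Ah) ∧
        Tendsto (flux (weightField f)) atTop (𝓝 L) ∧
        Tendsto (flux (weightField fh)) atTop (𝓝 Lh) ∧
        |(A + 2 * L) - (Ah + 2 * Lh)| < ε := by
  have hn' : (1 : ℝ) ≤ n := by exact_mod_cast hn
  set β : ℝ := τ + 1 - n / 2 with hβ
  have hβ0 : 0 < β := by rw [hβ]; linarith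
  obtain ⟨r₀, hr₀, hpb⟩ := exists_pointBounds (n := n) hτ0 K
  obtain ⟨C, hC, hquad⟩ := exists_lintegral_quadError_le (n := n) hτ hK
  -- The tail constant: `c` from the difference of the `P`-scalar curvatures, and one `C` for the
  -- expansion error of each pair.
  set D : ℝ≥0∞ := c + ENNReal.ofReal (88 * n ^ 6) * (C + C) with hD
  have hDt : D ≠ ⊤ := by rw [hD]; finiteness
  have htail : Tendsto (fun r : ℝ => D.toReal * r ^ (-β)) atTop (𝓝 0) := by
    simpa using (tendsto_rpow_neg_atTop hβ0).const_mul D.toReal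
  -- The radius is fixed before `δ`, and without reference to the metrics.
  obtain ⟨r, hrD, hr⟩ := ((htail.eventually (gt_mem_nhds (half_pos hε))).and
    (eventually_ge_atTop r₀)).exists
  have hr2 : 2 ≤ r := hr₀.trans hr
  have hr1 : 1 < r := by linarith
  have hr0 : 0 < r := by linarith
  have hω : 0 ≤ sphereVolume n := ENNReal.toReal_nonneg
  -- The Lipschitz constant of the total flux through `S_r` with respect to the `C¹` distance: `2n`
  -- for the metric, `2 + 4K` for the weight, which counts twice.
  set Q : ℝ := r ^ (n - 1) * (n * sphereVolume n) * (2 * n + 2 * (2 + 4 * K)) with hQ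
  have hQ0 : 0 ≤ Q := by positivity
  refine ⟨ε / (2 * (Q + 1)), by positivity, ?_⟩
  set δ : ℝ := ε / (2 * (Q + 1)) with hδ
  have hδ0 : 0 < δ := by positivity
  have hδQ : Q * δ < ε / 2 := by
    rw [hδ, mul_div_assoc', div_lt_div_iff₀ (by positivity) (by norm_num)]
    nlinarith
  intro G Gh f fh hb hbh hdG hdf hR hRh hL hLh hP
  have hquad' : ∀ {G : Euc n → Matrix (Fin n) (Fin n) ℝ} {f : Euc n → ℝ}, EndBounds τ K G f →
      ∫⁻ x in {x : Euc n | r < ‖x‖}, ENNReal.ofReal (quadError τ K G f x) < ⊤ := fun h =>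
    (hquad _ _ h r hr1.le).trans_lt (ENNReal.mul_lt_top hC.lt_top ENNReal.ofReal_lt_top)
  have hadm : ∀ {G : Euc n → Matrix (Fin n) (Fin n) ℝ} {f : Euc n → ℝ}, EndBounds τ K G f →
      ∀ i, ContDiffOn ℝ ∞ (admField G i) (exterior n) := fun h =>
    contDiffOn_admField isOpen_exterior h.contDiffOn_metric
  have hwt : ∀ {G : Euc n → Matrix (Fin n) (Fin n) ℝ} {f : Euc n → ℝ}, EndBounds τ K G f →
      ∀ i, ContDiffOn ℝ ∞ (weightField f i) (exterior n) := fun h =>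
    contDiffOn_weightField isOpen_exterior h.weight.smooth
  have hext : ∀ {x : Euc n}, r < ‖x‖ → x ∈ exterior n := fun hx => hr1.trans hx
  have iadm : ∀ {G : Euc n → Matrix (Fin n) (Fin n) ℝ} {f : Euc n → ℝ}, EndBounds τ K G f →
      ∫⁻ x in exterior n, ‖scalarCurvature G x‖ₑ < ⊤ →
      IntegrableOn (divergence (admField G)) {x : Euc n | r < ‖x‖} := fun {G f} h hR =>
    integrableOn_divergence (hadm h) hr1.le hR (measurable_quadError τ K G f) (hquad' h)
      (by positivity) fun x hx => (hpb G f h x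
        (hr.trans hx.le)).abs_divergence_admField_sub_scalarCurvature_le hn isOpen_exterior
        h.contDiffOn_metric (hext hx)
  have iwt : ∀ {G : Euc n → Matrix (Fin n) (Fin n) ℝ} {f : Euc n → ℝ}, EndBounds τ K G f →
      ∫⁻ x in exterior n, ‖laplacian G f x‖ₑ < ⊤ →
      IntegrableOn (divergence (weightField f)) {x : Euc n | r < ‖x‖} := fun {G f} h hL =>
    integrableOn_divergence (hwt h) hr1.le hL (measurable_quadError τ K G f) (hquad' h)
      (by positivity) fun x hx => (hpb G f h x
        (hr.trans hx.le)).abs_divergence_weightField_sub_laplacian_le hn isOpen_exterior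
        h.weight.smooth (hext hx)
  have i1 := iadm hb hR
  have i2 := iadm hbh hRh
  have i3 := iwt hb hL
  have i4 := iwt hbh hLh
  refine ⟨_, _, _, _, tendsto_flux hn (hadm hb) hr1 i1, tendsto_flux hn (hadm hbh) hr1 i2,
    tendsto_flux hn (hwt hb) hr1 i3, tendsto_flux hn (hwt hbh) hr1 i4, ?_⟩
  -- The divergences are combined before being estimated: only the difference of the `P`-scalar
  -- curvatures is bounded by `c`, not those of `R` and `Δf` separately.
  set X : Euc n → ℝ := fun x => (divergence (admField G) x + 2 * divergence (weightField f) x) -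
    (divergence (admField Gh) x + 2 * divergence (weightField fh) x) with hX
  have hXint : ∫ x in {x : Euc n | r < ‖x‖}, X x =
      ((∫ x in {x : Euc n | r < ‖x‖}, divergence (admField G) x) +
        2 * ∫ x in {x : Euc n | r < ‖x‖}, divergence (weightField f) x) -
      ((∫ x in {x : Euc n | r < ‖x‖}, divergence (admField Gh) x) +
        2 * ∫ x in {x : Euc n | r < ‖x‖}, divergence (weightField fh) x) := by
    have j1 : IntegrableOn (fun x => divergence (admField G) x + 2 * divergence (weightField f) x)
        {x : Euc n | r < ‖x‖} := i1.add (i3.const_mul 2)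
    have j2 : IntegrableOn
        (fun x => divergence (admField Gh) x + 2 * divergence (weightField fh) x)
        {x : Euc n | r < ‖x‖} := i2.add (i4.const_mul 2)
    simp only [hX]
    rw [integral_sub j1 j2, integral_add i1 (i3.const_mul 2), integral_add i2 (i4.const_mul 2), integral_const_mul,
      integral_const_mul]
  have hXle : |∫ x in {x : Euc n | r < ‖x‖}, X x| < ε / 2 := by
    have hpt : ∀ x ∈ {x : Euc n | r < ‖x‖}, ‖X x‖ₑ ≤
        ‖pScalarCurvature G f x - pScalarCurvature Gh fh x‖ₑ + ENNReal.ofReal (88 * n ^ 6) *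
          (ENNReal.ofReal (quadError τ K G f x) + ENNReal.ofReal (quadError τ K Gh fh x)) := by
      intro x hx
      have b1 := (hpb G f hb x (hr.trans (le_of_lt hx))).abs_divergence_sub_pScalarCurvature_le hn
        isOpen_exterior hb.contDiffOn_metric hb.weight.smooth (hext hx)
      have b2 := (hpb Gh fh hbh x
        (hr.trans (le_of_lt hx))).abs_divergence_sub_pScalarCurvature_le hn
        isOpen_exterior hbh.contDiffOn_metric hbh.weight.smooth (hext hx)
      have q1 := quadError_nonneg (τ := τ) hK G f x
      have q2 := quadError_nonneg (τ := τ) hK Gh fh x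
      rw [Real.enorm_eq_ofReal_abs, Real.enorm_eq_ofReal_abs, ← ENNReal.ofReal_add q1 q2,
        ← ENNReal.ofReal_mul (by positivity), ← ENNReal.ofReal_add (abs_nonneg _) (by positivity)]
      refine ENNReal.ofReal_le_ofReal ?_
      change |divergence (admField G) x + 2 * divergence (weightField f) x -
        pScalarCurvature G f x| ≤ 88 * n ^ 6 * quadError τ K G f x at b1
      change |divergence (admField Gh) x + 2 * divergence (weightField fh) x -
        pScalarCurvature Gh fh x| ≤ 88 * n ^ 6 * quadError τ K Gh fh x at b2
      have b3 := le_abs_self (pScalarCurvature G f x - pScalarCurvature Gh fh x)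
      have b4 := neg_abs_le (pScalarCurvature G f x - pScalarCurvature Gh fh x)
      rw [abs_le] at b1 b2 ⊢
      simp only [hX]
      constructor <;> linarith [b1.1, b1.2, b2.1, b2.2]
    have hle : ‖∫ x in {x : Euc n | r < ‖x‖}, X x‖ₑ ≤ D * ENNReal.ofReal (r ^ (-β)) := by
      refine (enorm_integral_le_lintegral_enorm _).trans
        ((setLIntegral_mono' (measurableSet_lt_norm r) hpt).trans ?_)
      have m1 := (measurable_quadError τ K G f).ennreal_ofReal
      have m2 := (measurable_quadError τ K Gh fh).ennreal_ofReal
      have m3 : Measurable fun x => ENNReal.ofReal (88 * n ^ 6) *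
          (ENNReal.ofReal (quadError τ K G f x) + ENNReal.ofReal (quadError τ K Gh fh x)) :=
        (m1.add m2).const_mul _
      rw [lintegral_add_right _ m3,
        lintegral_const_mul' _ _ ENNReal.ofReal_ne_top, lintegral_add_left m1, hD, add_mul,
        mul_assoc (ENNReal.ofReal _), add_mul]
      refine add_le_add ((lintegral_tail_le hβ0 _ hr1.le).trans (mul_le_mul_left hP _))
        (mul_le_mul_right (add_le_add (hquad G f hb r hr1.le) (hquad Gh fh hbh r hr1.le)) _)
    have := ENNReal.toReal_mono (by finiteness) hle
    rw [toReal_enorm, Real.norm_eq_abs, ENNReal.toReal_mul,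
      ENNReal.toReal_ofReal (by positivity)] at this
    exact this.trans_lt hrD
  have hdiff : ∀ {u : Euc n → ℝ} {x : Euc n}, ContDiffOn ℝ ∞ u (exterior n) → ‖x‖ = r →
      DifferentiableAt ℝ u x := fun {u x} hu hx =>
    differentiableAt_of_contDiffOn isOpen_exterior hu (show 1 < ‖x‖ by rw [hx]; exact hr1)
  have hfluxA : |flux (admField G) r - flux (admField Gh) r| ≤
      r ^ (n - 1) * (n * (n * (2 * δ)) * sphereVolume n) :=
    abs_flux_sub_flux_le (hadm hb) (hadm hbh) hr1 fun i x hx =>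
      abs_admField_sub_le (fun i j => hdiff (hb.contDiffOn_metric i j) hx)
        (fun i j => hdiff (hbh.contDiffOn_metric i j) hx)
        (fun k i j => ((hdG i j).abs_le_const hτ0 hδ0.le (by rw [hx]; exact hr2)).2 k) i
  have hhalf : ∀ {G : Euc n → Matrix (Fin n) (Fin n) ℝ} {f : Euc n → ℝ}, EndBounds τ K G f →
      ∀ x, ‖x‖ = r → |f x| ≤ 1 / 2 := by
    intro G f h x hx
    have pb := hpb G f h x (by rw [hx]; exact hr)
    have h1 := pb.small
    have h2 : 0 ≤ K * ‖x‖ ^ (-τ) := by positivity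
    have h3 := pb.weight_le
    nlinarith
  have hfluxW : |flux (weightField f) r - flux (weightField fh) r| ≤
      r ^ (n - 1) * (n * ((2 + 4 * K) * δ) * sphereVolume n) :=
    abs_flux_sub_flux_le (hwt hb) (hwt hbh) hr1 fun i x hx => by
      have hx2 : 2 ≤ ‖x‖ := by rw [hx]; exact hr2
      have h1 := hdf.abs_le_const hτ0 hδ0.le hx2
      exact abs_weightField_sub_le (hdiff hb.weight.smooth hx) (hdiff hbh.weight.smooth hx)
        (hhalf hb x hx) (hhalf hbh x hx) h1.1 h1.2 (hbh.weight.abs_le_const hτ0 hK hx2).2 i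
  have hflux : |flux (admField G) r - flux (admField Gh) r| +
      2 * |flux (weightField f) r - flux (weightField fh) r| ≤ Q * δ := by
    refine (add_le_add hfluxA (mul_le_mul_of_nonneg_left hfluxW (by norm_num))).trans (le_of_eq ?_)
    rw [hQ]
    ring
  rw [hXint] at hXle
  have h1 := abs_lt.1 hXle
  have h2 := neg_abs_le (flux (admField G) r - flux (admField Gh) r)
  have h3 := le_abs_self (flux (admField G) r - flux (admField Gh) r)
  have h4 := neg_abs_le (flux (weightField f) r - flux (weightField fh) r)
  have h5 := le_abs_self (flux (weightField f) r - flux (weightField fh) r)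
  rw [abs_lt]
  constructor <;> linarith [h1.1, h1.2]

end MassComparison

/-! ### From the norms on the manifold to the coordinates of an end. -/

section Manifold

variable {n : ℕ} {M : Type*} [TopologicalSpace M] [ChartedSpace (Euc n) M]
  [IsManifold (𝓡 n) ∞ M]

theorem sphereVolume_pos (hn : 1 ≤ n) : 0 < sphereVolume n := by
  have : Nonempty (Fin n) := ⟨⟨0, hn⟩⟩
  refine ENNReal.toReal_pos ?_ (measure_ne_top _ _)
  rw [ne_eq, Measure.measure_univ_eq_zero]
  exact Measure.toSphere_ne_zero _

theorem isWeightedMass_of_tendsto_flux (hn : 2 ≤ n) (g : RiemMetric n M) (f : M → ℝ)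
    (Φ : OpenPartialHomeomorph M (Euc n)) {A L : ℝ}
    (hA : Tendsto (flux (admField (components g Φ))) atTop (𝓝 A))
    (hL : Tendsto (flux (weightField (inChart f Φ))) atTop (𝓝 L)) :
    IsWeightedMass g f Φ (A + 2 * L) := by
  have hn' : (2 : ℝ) ≤ n := by exact_mod_cast hn
  have hω := sphereVolume_pos (n := n) (by lia)
  have hc : 2 * ((n : ℝ) - 1) * sphereVolume n ≠ 0 :=
    mul_ne_zero (mul_ne_zero two_ne_zero (by linarith)) hω.ne'
  refine ⟨1 / (2 * ((n : ℝ) - 1) * sphereVolume n) * A, L, ?_, ?_, ?_⟩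
  · have e : (fun ρ : ℝ => 1 / (2 * ((n : ℝ) - 1) * sphereVolume n) *
        flux (admField (components g Φ)) ρ) = fun ρ : ℝ =>
        1 / (2 * ((n : ℝ) - 1) * sphereVolume n) * sphereIntegral ρ fun x ν => ∑ i, ∑ j,
          (pd j (fun y => components g Φ y i j) x - pd i (fun y => components g Φ y j j) x) *
            ν i := by
      funext ρ
      simp only [flux, admField, Finset.sum_mul]
    have := hA.const_mul (1 / (2 * ((n : ℝ) - 1) * sphereVolume n))
    rw [e] at this
    exact this
  · have e : flux (weightField (inChart f Φ)) = fun ρ : ℝ => sphereIntegral ρ fun x ν =>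
        ∑ i, pd i (inChart f Φ) x * ν i * Real.exp (-(inChart f Φ x)) := by
      funext ρ
      simp only [flux, weightField]
      congr 1
      funext x ν
      exact Finset.sum_congr rfl fun i _ => by ring
    rw [e] at hL
    exact hL
  · rw [← mul_assoc, mul_one_div_cancel hc, one_mul]

theorem EndStructure.weightedNorm_le_norm (S : EndStructure n M) (k : ℕ) (p : ℝ≥0∞) (s : ℝ)
    (u : OpenPartialHomeomorph M (Euc n) → Euc n → ℝ) (e : Fin S.N) :
    weightedNorm k p s (u (S.endChart e)) ≤ S.norm k p s u :=
  (Finset.single_le_sum (f := fun e => weightedNorm k p s (u (S.endChart e)))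
    (fun _ _ => zero_le) (Finset.mem_univ e)).trans le_self_add

theorem le_sum_sum_fin (F : Fin n → Fin n → ℝ≥0∞) (i j : Fin n) : F i j ≤ ∑ i, ∑ j, F i j :=
  (Finset.single_le_sum (f := fun j => F i j) (fun _ _ => zero_le) (Finset.mem_univ j)).trans
    (Finset.single_le_sum (f := fun i => ∑ j, F i j) (fun _ _ => zero_le) (Finset.mem_univ i))

/-- The weights combine as `-n + (2τ + 2) = 2β`: the `L¹_{-2τ-2}` norm gains a positive power over
the plain `L¹` norm. -/
theorem lintegral_le_weightedNorm_one {τ : ℝ} (w : Euc n → ℝ) :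
    ∫⁻ x in exterior n, ENNReal.ofReal (‖x‖ ^ (2 * (τ + 1 - n / 2))) * ‖w x‖ₑ ≤
      weightedNorm 0 1 (-2 * τ - 2) w := by
  refine le_trans (le_of_eq ?_) (eLpNorm_pdList_le_weightedNorm (k := 0) (m := 0) le_rfl
    (I := Fin.elim0) (fun a => a.elim0) 1 (-2 * τ - 2) w)
  rw [eLpNorm_one_eq_lintegral_enorm, lintegral_scaleMeasure]
  refine setLIntegral_congr_fun isOpen_exterior.measurableSet fun x hx => ?_
  have hx0 : 0 < ‖x‖ := lt_trans one_pos hx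
  change _ = ENNReal.ofReal (‖x‖ ^ (-(n : ℝ))) * ‖w x * ‖x‖ ^ (((0 : ℕ) : ℝ) - (-2 * τ - 2))‖ₑ
  rw [enorm_mul, Real.enorm_of_nonneg (Real.rpow_nonneg (norm_nonneg x) _), mul_left_comm,
    ← ENNReal.ofReal_mul (by positivity), ← Real.rpow_add hx0, mul_comm]
  congr 3
  push_cast
  ring

end Manifold

end WeightedMass

end

/-! ### The theorem: choice of the constants. -/

theorem mainTheorem8 (n : ℕ) (hn : 3 ≤ n) (p τ : ℝ) (hp : (n : ℝ) < p)
    (hτ : ((n : ℝ) - 2) / 2 < τ) (hτ' : τ < (n : ℝ) - 2)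
    (ε : ℝ) (hε : 0 < ε) (a b c : ℝ≥0) :
    ∃ δ : ℝ, 0 < δ ∧
      ∀ (M : Type*) [TopologicalSpace M] [T2Space M] [SecondCountableTopology M]
        [ChartedSpace (WeightedMass.Euc n) M] [IsManifold (𝓡 n) ∞ M]
        (S : WeightedMass.EndStructure n M)
        (g ghat : WeightedMass.RiemMetric n M) (f fhat : M → ℝ),
        S.IsAF p τ g f → S.IsAF p τ ghat fhat →
        ∑ e, S.endNormSubEuclidean 2 (ENNReal.ofReal p) (-τ) g e ≤ a →
        S.norm 2 (ENNReal.ofReal p) (-τ) (WeightedMass.inChart f) ≤ b →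
        S.norm 0 1 (-2 * τ - 2)
          (fun φ x => WeightedMass.pScalar g f φ x - WeightedMass.pScalar ghat fhat φ x) ≤ c →
        S.normMetricSub 2 (ENNReal.ofReal p) (-τ) ghat g < ENNReal.ofReal δ →
        S.norm 2 (ENNReal.ofReal p) (-τ)
          (fun φ x => WeightedMass.inChart fhat φ x - WeightedMass.inChart f φ x)
            < ENNReal.ofReal δ →
        ∀ k : Fin S.N, ∃ m mhat : ℝ,
          WeightedMass.IsWeightedMass g f (S.endChart k) m ∧
          WeightedMass.IsWeightedMass ghat fhat (S.endChart k) mhat ∧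
          |m - mhat| < ε := by
  have hn' : (3 : ℝ) ≤ n := by exact_mod_cast hn
  obtain ⟨C, hC, hdecay⟩ :=
    WeightedMass.exists_decayBound_of_weightedNorm_le (n := n) (by lia) hp hτ
  -- One decay constant for both pairs; the summand 1 accounts for the perturbation, whose norm is
  -- kept below 1.
  set K : ℝ := C * (a + b + 1) with hK
  have hK0 : 0 ≤ K := by positivity
  obtain ⟨δ, hδ, hmass⟩ := WeightedMass.exists_abs_mass_sub_lt (n := n) (by lia) (τ := τ)
    (by linarith) hτ hK0 c hε
  -- Division by `C` turns smallness in norm into the decay bound `δ`; the cap 1 ensures that the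
  -- perturbed pair still has decay constant `K`.
  refine ⟨min 1 (δ / C), by positivity, ?_⟩
  intro M _ _ _ _ _ S g ghat f fhat hAF hAFh ha hb hc hg hf k
  set δ' : ℝ := min 1 (δ / C) with hδ'
  have hδ'0 : 0 ≤ δ' := by positivity
  have hδ'1 : δ' ≤ 1 := min_le_left _ _
  have hCδ : C * δ' ≤ δ := by
    calc C * δ' ≤ C * (δ / C) := by gcongr; exact min_le_right _ _
      _ = δ := by field_simp
  set Φ := S.endChart k with hΦ
  have hΦmem := S.endChart_mem k
  have htarget : Φ.target = WeightedMass.exterior n := S.endChart_target k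
  have hGs : ∀ (g : WeightedMass.RiemMetric n M) (i j : Fin n),
      ContDiffOn ℝ ∞ (fun x => WeightedMass.components g Φ x i j) (WeightedMass.exterior n) :=
    fun g i j => htarget ▸ WeightedMass.contDiffOn_components g Φ hΦmem i j
  have hfs : ∀ f : M → ℝ, ContMDiff (𝓡 n) 𝓘(ℝ, ℝ) ∞ f →
      ContDiffOn ℝ ∞ (WeightedMass.inChart f Φ) (WeightedMass.exterior n) :=
    fun f hf => htarget ▸ WeightedMass.contDiffOn_inChart f hf Φ hΦmem
  have dG : ∀ i j, WeightedMass.DecayBound τ (C * a) fun x =>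
      WeightedMass.components g Φ x i j - (1 : Matrix (Fin n) (Fin n) ℝ) i j := fun i j => by
    refine hdecay _ a a.2 ((hGs g i j).sub contDiffOn_const) ?_
    rw [ENNReal.ofReal_coe_nnreal]
    exact ((WeightedMass.le_sum_sum_fin (fun i j => WeightedMass.weightedNorm 2
      (ENNReal.ofReal p) (-τ) fun x => WeightedMass.components g Φ x i j -
        (1 : Matrix (Fin n) (Fin n) ℝ) i j) i j).trans (Finset.single_le_sum
      (f := fun e => S.endNormSubEuclidean 2 (ENNReal.ofReal p) (-τ) g e)
      (fun _ _ => zero_le) (Finset.mem_univ k))).trans ha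
  have dF : WeightedMass.DecayBound τ (C * b) (WeightedMass.inChart f Φ) := by
    refine hdecay _ b b.2 (hfs f hAF.smooth) ?_
    rw [ENNReal.ofReal_coe_nnreal]
    exact (S.weightedNorm_le_norm _ _ _ (WeightedMass.inChart f) k).trans hb
  have dGd : ∀ i j, WeightedMass.DecayBound τ (C * δ') fun x =>
      WeightedMass.components ghat Φ x i j - WeightedMass.components g Φ x i j := fun i j => by
    refine hdecay _ δ' hδ'0 ((hGs ghat i j).sub (hGs g i j)) ?_
    exact ((S.weightedNorm_le_norm _ _ _ (fun φ x => WeightedMass.components ghat φ x i j -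
      WeightedMass.components g φ x i j) k).trans (WeightedMass.le_sum_sum_fin
        (fun i j => S.norm 2 (ENNReal.ofReal p) (-τ) fun φ x =>
          WeightedMass.components ghat φ x i j - WeightedMass.components g φ x i j) i j)).trans
      hg.le
  have dFd : WeightedMass.DecayBound τ (C * δ') fun x =>
      WeightedMass.inChart fhat Φ x - WeightedMass.inChart f Φ x := by
    refine hdecay _ δ' hδ'0 ((hfs fhat hAFh.smooth).sub (hfs f hAF.smooth)) ?_
    exact (S.weightedNorm_le_norm _ _ _ (fun φ x => WeightedMass.inChart fhat φ x -
      WeightedMass.inChart f φ x) k).trans hf.le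
  have ha0 : 0 ≤ C * (a : ℝ) := by positivity
  have hb0 : 0 ≤ C * (b : ℝ) := by positivity
  have hd0 : 0 ≤ C * δ' := by positivity
  have hd1 : C * δ' ≤ C := mul_le_of_le_one_right hC.le hδ'1
  have hKe : K = C * a + C * b + C := by rw [hK]; ring
  have hE : WeightedMass.EndBounds τ K (WeightedMass.components g Φ) (WeightedMass.inChart f Φ) :=
    ⟨fun i j => (dG i j).mono (by linarith), dF.mono (by linarith)⟩
  -- The quantitative bound for the second pair is not assumed; it follows from the first pair and
  -- the difference by the triangle inequality.
  have hEh : WeightedMass.EndBounds τ K (WeightedMass.components ghat Φ)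
      (WeightedMass.inChart fhat Φ) := by
    refine ⟨fun i j => ?_, ?_⟩
    · have h := ((dG i j).add ha0 hd0 (dGd i j)).mono (show _ ≤ K by linarith)
      have e : (fun x => WeightedMass.components ghat Φ x i j -
          (1 : Matrix (Fin n) (Fin n) ℝ) i j) = fun x =>
          (WeightedMass.components g Φ x i j - (1 : Matrix (Fin n) (Fin n) ℝ) i j) +
          (WeightedMass.components ghat Φ x i j - WeightedMass.components g Φ x i j) := by
        funext x; ring
      rw [e]
      exact h
    · have h := (dF.add hb0 hd0 dFd).mono (show _ ≤ K by linarith)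
      have e : WeightedMass.inChart fhat Φ = fun x => WeightedMass.inChart f Φ x +
          (WeightedMass.inChart fhat Φ x - WeightedMass.inChart f Φ x) := by
        funext x; ring
      rw [e]
      exact h
  have hR : ∀ (g : WeightedMass.RiemMetric n M) (f : M → ℝ), S.IsAF p τ g f →
      ∫⁻ x in WeightedMass.exterior n,
        ‖WeightedMass.scalarCurvature (WeightedMass.components g Φ) x‖ₑ < ⊤ := fun g f h =>
    WeightedMass.lintegral_lt_top_of_weightedNorm_top hτ ((S.weightedNorm_le_norm _ _ _
      (fun φ => WeightedMass.scalarCurvature (WeightedMass.components g φ)) k).trans_lt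
        h.scalar_decay)
  have hL : ∀ (g : WeightedMass.RiemMetric n M) (f : M → ℝ), S.IsAF p τ g f →
      ∫⁻ x in WeightedMass.exterior n, ‖WeightedMass.laplacian (WeightedMass.components g Φ)
        (WeightedMass.inChart f Φ) x‖ₑ < ⊤ := fun g f h =>
    WeightedMass.lintegral_lt_top_of_weightedNorm_top hτ ((S.weightedNorm_le_norm _ _ _
      (fun φ => WeightedMass.laplacian (WeightedMass.components g φ) (WeightedMass.inChart f φ))
        k).trans_lt h.laplacian_decay)
  obtain ⟨A, Ah, L, Lh, hA, hAh, hLf, hLh, hlt⟩ := hmass _ _ _ _ hE hEh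
    (fun i j => (dGd i j).mono hCδ) (dFd.mono hCδ) (hR g f hAF) (hR ghat fhat hAFh)
    (hL g f hAF) (hL ghat fhat hAFh)
    ((WeightedMass.lintegral_le_weightedNorm_one _).trans ((S.weightedNorm_le_norm _ _ _
      (fun φ x => WeightedMass.pScalar g f φ x - WeightedMass.pScalar ghat fhat φ x) k).trans hc))
  exact ⟨A + 2 * L, Ah + 2 * Lh,
    WeightedMass.isWeightedMass_of_tendsto_flux (by lia) g f Φ hA hLf,
    WeightedMass.isWeightedMass_of_tendsto_flux (by lia) ghat fhat Φ hAh hLh, hlt⟩
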